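/- Let $G$ be a compactly generated totally disconnected locally compact (Hausdorff) group. Then $G$ is hyperbolic if and only if $G$ is compactly presented and satisfies the weak linear isoperimetric inequality. Here the following terminology is used. * $G$ is *compactly generated* if some compact subset generates it algebraically, and *compactly presented* if it has a presentation $\langle K\mid R\rangle$ in which $K$ is a compact subset of $G$ and the relators in $R$ have uniformly bounded length. * A *Cayley–Abels graph* of $G$ is a locally finite connected simplicial graph on which $G$ acts by automorphisms, transitively on vertices and with compact open vertex stabilizers. $G$ is *hyperbolic* if it is compactly generated and some Cayley–Abels graph of $G$ is Gromov hyperbolic for the edge-path metric, i.e. its geodesic triangles are uniformly slim. * A *finitely generated proper permutation $\mathbb{Q}[G]$-module* is a module $\mathbb{Q}[\Omega]$, where $\Omega$ is a non-empty $G$-set with finitely many orbits and compact open point stabilizers; its $\ell_1$-norm is $\|\sum_\omega \alpha_\omega\,\omega\|_1=\sum_\omega|\alpha_\omega|$. If $\partial\colon\mathbb{Q}[\Omega]\to M$ is a surjective morphism from such a module onto a $\mathbb{Q}[G]$-module $M$, then $\|m\|_\partial=\inf\{\|x\|_1 : x\in\mathbb{Q}[\Omega],\ \partial x=m\}$ is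 called a *filling (pseudo-)norm* of $M$. Two (pseudo-)norms $\nu,\mu$ are *equivalent* if $\nu\le C\mu$ and $\mu\le C'\nu$ for some constants $C,C'>0$. A submodule $N\subseteq M$ is *undistorted* if the restriction to $N$ of a filling norm of $M$ is equivalent to a filling norm of $N$. * $G$ satisfies the *weak linear isoperimetric inequality* if there is an exact sequence of $\mathbb{Q}[G]$-modules $$\mathbb{Q}[\Omega_2]\xrightarrow{\ \delta_2\ }\mathbb{Q}[\Omega_1]\xrightarrow{\ \delta_1\ }\mathbb{Q}[\Omega_0]\to\mathbb{Q}\to 0$$ with finitely generated proper permutation modules $\mathbb{Q}[\Omega_0],\mathbb{Q}[\Omega_1],\mathbb{Q}[\Omega_2]$ and the trivial module $\mathbb{Q}$, such that $\ker(\delta_1)$ is an undistorted submodule of $\mathbb{Q}[\Omega_1]$. -/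

import Mathlib

namespace TDLC

universe u v

/-! ### Compact generation and compact presentation -/

/-- A topological group is compactly generated if some compact subset generates it
algebraically. -/
def IsCompactlyGenerated (G : Type u) [Group G] [TopologicalSpace G] : Prop :=
  ∃ K : Set G, IsCompact K ∧ Subgroup.closure K = ⊤

/-- A topological group is compactly presented if it admits a presentation `⟨K ∣ R⟩` where `K` is
a compact subset of the group and the relators `R` (elements of the free group on `K`) are
represented by words of uniformly bounded length. -/
def IsCompactlyPresented (G : Type u) [Group G] [TopologicalSpace G] : Prop :=
  ∃ K : Set G, IsCompact K ∧ ∃ R : Set (FreeGroup K),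
    (∃ n : ℕ, ∀ r ∈ R, ∃ w : List (K × Bool), FreeGroup.mk w = r ∧ w.length ≤ n) ∧
    Function.Surjective (FreeGroup.lift (fun k : K => (k : G))) ∧
    (FreeGroup.lift (fun k : K => (k : G))).ker = Subgroup.normalClosure R

/-! ### Cayley-Abels graphs and hyperbolicity -/

/-- A Cayley-Abels graph of `G`: a locally finite connected graph on which `G` acts by graph
automorphisms, transitively on vertices, with compact open vertex stabilizers. -/
structure IsCayleyAbelsGraph (G : Type u) [Group G] [TopologicalSpace G]
    {V : Type v} [MulAction G V] (Γ : SimpleGraph V) : Prop where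
  adj_smul : ∀ (g : G) (x y : V), Γ.Adj x y → Γ.Adj (g • x) (g • y)
  connected : Γ.Connected
  locallyFinite : ∀ x : V, (Γ.neighborSet x).Finite
  transitive : ∀ x y : V, ∃ g : G, g • x = y
  isOpen_stabilizer : ∀ x : V, IsOpen (MulAction.stabilizer G x : Set G)
  isCompact_stabilizer : ∀ x : V, IsCompact (MulAction.stabilizer G x : Set G)

/-- A walk in a graph is geodesic if its length is the distance between its endpoints. -/
def IsGeodesicWalk {V : Type v} {Γ : SimpleGraph V} {x y : V} (p : Γ.Walk x y) : Prop :=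
  p.length = Γ.dist x y

/-- A connected graph is (Gromov) hyperbolic if its geodesic triangles are uniformly slim: for
some `δ`, each side of each geodesic triangle lies in the `δ`-neighbourhood of the union of the
other two sides. (Any side can play the role of `r`, by reversing walks.) -/
def IsHyperbolicGraph {V : Type v} (Γ : SimpleGraph V) : Prop :=
  Γ.Connected ∧ ∃ δ : ℕ, ∀ (x y z : V) (p : Γ.Walk x y) (q : Γ.Walk y z) (r : Γ.Walk x z),
    IsGeodesicWalk p → IsGeodesicWalk q → IsGeodesicWalk r →
      ∀ a ∈ r.support, ∃ b : V, (b ∈ p.support ∨ b ∈ q.support) ∧ Γ.dist a b ≤ δ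

/-- A topological group is hyperbolic if it is compactly generated and some Cayley-Abels graph of
it is hyperbolic. The vertex set of a Cayley-Abels graph is a quotient set of the group, so
nothing is lost by taking it in the same universe. -/
def IsHyperbolic (G : Type u) [Group G] [TopologicalSpace G] : Prop :=
  IsCompactlyGenerated G ∧ ∃ (V : Type u) (_ : MulAction G V) (Γ : SimpleGraph V),
    IsCayleyAbelsGraph G Γ ∧ IsHyperbolicGraph Γ

/-! ### Proper permutation modules and filling norms -/

/-- The non-empty `G`-sets with compact open stabilizers and finitely many orbits. Their rational
permutation modules `Representation.ofMulAction ℚ G Ω` are the finitely generated proper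
permutation `ℚ[G]`-modules. -/
structure IsFiniteTypeProper (G : Type u) [Group G] [TopologicalSpace G]
    (Ω : Type v) [MulAction G Ω] : Prop where
  nonempty : Nonempty Ω
  isOpen_stabilizer : ∀ ω : Ω, IsOpen (MulAction.stabilizer G ω : Set G)
  isCompact_stabilizer : ∀ ω : Ω, IsCompact (MulAction.stabilizer G ω : Set G)
  finite_orbits : Finite (MulAction.orbitRel.Quotient G Ω)

/-- The `ℓ¹`-norm `∑ |α_ω|` of an element `∑ α_ω ω` of `ℚ[Ω]`. -/
noncomputable def l1Norm {Ω : Type v} (x : MonoidAlgebra ℚ Ω) : ℝ :=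
  x.coeff.sum fun _ a => |(a : ℝ)|

/-- `ν` is a filling (pseudo-)norm of the `ℚ[G]`-module `M`: there are a finitely generated proper
permutation module `ℚ[Ω]` and a surjective morphism `∂ : ℚ[Ω] → M` of `ℚ[G]`-modules such that
`ν m` is the infimum of `‖x‖₁` over all `x` with `∂ x = m`. -/
def IsFillingNorm {G : Type u} [Group G] [TopologicalSpace G]
    {M : Type v} [AddCommGroup M] [Module ℚ M] (ρ : Representation ℚ G M) (ν : M → ℝ) : Prop :=
  ∃ (Ω : Type u) (_ : MulAction G Ω), IsFiniteTypeProper G Ω ∧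
    ∃ d : (Representation.ofMulAction ℚ G Ω).IntertwiningMap ρ, Function.Surjective d ∧
      ∀ m : M, ν m = sInf {t : ℝ | ∃ x : MonoidAlgebra ℚ Ω, d x = m ∧ t = l1Norm x}

/-- Equivalence of two (pseudo-)norms. -/
def NormEquiv {M : Type v} (ν μ : M → ℝ) : Prop :=
  (∃ C : ℝ, 0 < C ∧ ∀ m, ν m ≤ C * μ m) ∧ (∃ C : ℝ, 0 < C ∧ ∀ m, μ m ≤ C * ν m)

/-- A submodule `N` of the `ℚ[G]`-module `M` is undistorted if the restriction to `N` of a filling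
norm of `M` is equivalent to a filling norm of `N`. -/
def IsUndistorted {G : Type u} [Group G] [TopologicalSpace G]
    {M : Type v} [AddCommGroup M] [Module ℚ M] {ρ : Representation ℚ G M}
    (N : Subrepresentation ρ) : Prop :=
  ∃ (μ : M → ℝ) (ν : N.toSubmodule → ℝ), IsFillingNorm ρ μ ∧
    IsFillingNorm N.toRepresentation ν ∧ NormEquiv (fun m : N.toSubmodule => μ (m : M)) ν

/-! ### The weak linear isoperimetric inequality -/

/-- `ℚ[Ω₂] → ℚ[Ω₁] → ℚ[Ω₀] → ℚ → 0` is a partial proper permutation resolution of finite type of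
the trivial `ℚ[G]`-module `ℚ`. -/
structure IsPartialResolution {G : Type u} [Group G] [TopologicalSpace G]
    {Ω₀ Ω₁ Ω₂ : Type u} [MulAction G Ω₀] [MulAction G Ω₁] [MulAction G Ω₂]
    (d₂ : (Representation.ofMulAction ℚ G Ω₂).IntertwiningMap (Representation.ofMulAction ℚ G Ω₁))
    (d₁ : (Representation.ofMulAction ℚ G Ω₁).IntertwiningMap (Representation.ofMulAction ℚ G Ω₀))
    (ε : (Representation.ofMulAction ℚ G Ω₀).IntertwiningMap (Representation.trivial ℚ G ℚ)) :
    Prop where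
  proper₀ : IsFiniteTypeProper G Ω₀
  proper₁ : IsFiniteTypeProper G Ω₁
  proper₂ : IsFiniteTypeProper G Ω₂
  surjective : Function.Surjective ε
  exact₀ : Function.Exact d₁ ε
  exact₁ : Function.Exact d₂ d₁

/-- `G` satisfies the weak (one-dimensional) linear isoperimetric inequality: the trivial module
`ℚ` has a partial proper permutation resolution `ℚ[Ω₂] → ℚ[Ω₁] → ℚ[Ω₀] → ℚ → 0` of finite type
in which the kernel of `ℚ[Ω₁] → ℚ[Ω₀]` is an undistorted submodule of `ℚ[Ω₁]`. -/
def WeakLinearIsoperimetricInequality (G : Type u) [Group G] [TopologicalSpace G] : Prop :=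
  ∃ (Ω₀ Ω₁ Ω₂ : Type u) (_ : MulAction G Ω₀) (_ : MulAction G Ω₁) (_ : MulAction G Ω₂)
    (d₂ : (Representation.ofMulAction ℚ G Ω₂).IntertwiningMap (Representation.ofMulAction ℚ G Ω₁))
    (d₁ : (Representation.ofMulAction ℚ G Ω₁).IntertwiningMap (Representation.ofMulAction ℚ G Ω₀))
    (ε : (Representation.ofMulAction ℚ G Ω₀).IntertwiningMap (Representation.trivial ℚ G ℚ)),
    IsPartialResolution d₂ d₁ ε ∧ IsUndistorted d₁.ker

end TDLC

/-! Hyperbolicity implies the two finiteness conditions by Dehn's algorithm. In a graph with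
`δ`-slim triangles, every closed walk of length at least 4δ+4 has a subwalk of length at most 4δ+4
that is not geodesic (`IsSlim.exists_shortcut`). Otherwise the walk would be geodesic near its point
farthest from the base point, and slimness of the triangle spanned by that segment and the base
point would contradict maximality.

Applied to the path traced by a word, repeated shortening gives a compact presentation with relators
of bounded length (`IsCayleyAbelsGraph.isCompactlyPresented`). Applied to closed walks, it gives
fillings of linear size in the Rips complex on vertices, pairs and triples at pairwise distance at
most R = 4δ+4 (`IsSlim.hasFilling_closedWalk`). A rational cycle, once scaled to be integral, is
traded edge by edge for closed walks of total length at most R times its norm, so every cycle m has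
a filling of norm O(‖m‖₁) (`IsSlim.hasFilling_cycle`). This yields both exactness in degree one and
undistortedness of the kernel.

For the converse, the idea is to integrate. For Lipschitz functions f and g on the vertices, "f dg"
extends to a linear functional on the 1-chains of the given resolution. If f is constant it vanishes
on cycles. The generating cycles have uniformly bounded support and f is nearly constant on each, so
the functional is uniformly bounded on them. Undistortedness turns this into a bound by the ℓ¹-norm
on all cycles, and hence the integral of f dg along a closed walk is at most a constant times its
length (`IsCayleyAbelsGraph.exists_hasLinearArea`).

Such a linear area bound forces hyperbolicity. If a quasigeodesic strays as far as D from a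
geodesic, a piece of it of length O(D) is closed up along the geodesic. Taking for f the distance to
the closing path and for g the parameter, the integral is at least D²/2 while the length is O(D), so
D is bounded (`HasLinearArea.distTo_geodesic_le`). Slim triangles follow by nearest-point
projection: a geodesic running to the projection of a point and then a geodesic to the point itself
form a 3-quasigeodesic (`HasLinearArea.close_of_nearest`). -/

namespace TDLC

/-! ### Discrete line integrals and slim triangles -/

section LineIntegral

variable {V : Type*} {Γ : SimpleGraph V}

/-- The discrete line integral `∫ f dg` along a walk. -/
def lineIntegral (f g : V → ℝ) : {u v : V} → Γ.Walk u v → ℝ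
  | _, _, .nil => 0
  | u, _, .cons (v := v) _ p => f u * (g v - g u) + lineIntegral f g p

@[simp] lemma lineIntegral_nil (f g : V → ℝ) (u : V) :
    lineIntegral f g (.nil : Γ.Walk u u) = 0 := rfl

@[simp] lemma lineIntegral_cons (f g : V → ℝ) {u v w : V} (h : Γ.Adj u v) (p : Γ.Walk v w) :
    lineIntegral f g (.cons h p) = f u * (g v - g u) + lineIntegral f g p := rfl

lemma lineIntegral_append (f g : V → ℝ) {u v w : V} (p : Γ.Walk u v) (q : Γ.Walk v w) :
    lineIntegral f g (p.append q) = lineIntegral f g p + lineIntegral f g q := by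
  induction p with
  | nil => simp
  | cons h p ih => simp [ih, add_assoc]

lemma lineIntegral_eq_zero (f g : V → ℝ) {u v : V} (p : Γ.Walk u v)
    (h : ∀ a ∈ p.support, f a = 0) : lineIntegral f g p = 0 := by
  induction p with
  | nil => rfl
  | cons h' p ih =>
    simp only [SimpleGraph.Walk.support_cons, List.mem_cons, forall_eq_or_imp] at h
    simp [h.1, ih h.2]

/-- A function on the vertices is `3`-Lipschitz for the path metric. -/
def IsThreeLipschitz (Γ : SimpleGraph V) (f : V → ℝ) : Prop :=
  ∀ x y, |f x - f y| ≤ 3 * Γ.dist x y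

/-- Line integrals of Lipschitz functions along closed walks are bounded by a multiple of the
length of the walk. -/
def HasLinearArea (Γ : SimpleGraph V) (C : ℝ) : Prop :=
  ∀ f g : V → ℝ, IsThreeLipschitz Γ f → IsThreeLipschitz Γ g →
    ∀ (v : V) (p : Γ.Walk v v), |lineIntegral f g p| ≤ C * p.length

/-- A sequence of adjacent vertices gives a walk. -/
lemma exists_walk_of_seq_add (c : ℕ → V) (i s : ℕ) 
    (h : ∀ k, i ≤ k → k < i + s → Γ.Adj (c k) (c (k + 1))) :
    ∃ p : Γ.Walk (c i) (c (i + s)), p.length = s ∧ (∀ k ≤ s, c (i + k) ∈ p.support) ∧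
      ∀ f g : V → ℝ, lineIntegral f g p =
        ∑ k ∈ Finset.range s, f (c (i + k)) * (g (c (i + k + 1)) - g (c (i + k))) := by
  induction s with
  | zero => exact ⟨.nil, rfl, by simp, by simp⟩
  | succ s ih =>
    obtain ⟨p, hl, hs, hI⟩ := ih fun k h1 h2 => h k h1 (by omega)
    have ha : Γ.Adj (c (i + s)) (c (i + (s + 1))) := h (i + s) (by omega) (by omega)
    refine ⟨p.append (.cons ha .nil), by simp [hl], fun k hk => ?_, fun f g => ?_⟩
    · rw [SimpleGraph.Walk.mem_support_append_iff]
      rcases Nat.lt_or_ge k (s + 1) with h1 | h1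
      · exact .inl (hs k (by omega))
      · obtain rfl : k = s + 1 := by omega
        exact .inr (by simp)
    · rw [lineIntegral_append, hI, Finset.sum_range_succ]
      simp [add_assoc]

/-- A sequence of adjacent vertices gives a walk between any two of its members. -/
lemma exists_walk_of_seq (c : ℕ → V) {i j : ℕ} (hij : i ≤ j)
    (h : ∀ k, i ≤ k → k < j → Γ.Adj (c k) (c (k + 1))) :
    ∃ p : Γ.Walk (c i) (c j), p.length = j - i ∧ (∀ k ≤ j - i, c (i + k) ∈ p.support) ∧
      ∀ f g : V → ℝ, lineIntegral f g p =
        ∑ k ∈ Finset.range (j - i), f (c (i + k)) * (g (c (i + k + 1)) - g (c (i + k))) := by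
  obtain ⟨s, rfl⟩ := Nat.exists_eq_add_of_le hij
  rw [Nat.add_sub_cancel_left]
  exact exists_walk_of_seq_add c i s h

/-- The distance of a vertex to a finite set of vertices. -/
noncomputable def distTo (Γ : SimpleGraph V) (S : Finset V) (hS : S.Nonempty) (v : V) : ℕ :=
  S.inf' hS fun s => Γ.dist v s

lemma distTo_le (S : Finset V) (hS : S.Nonempty) (v : V) {s : V} (hs : s ∈ S) :
    distTo Γ S hS v ≤ Γ.dist v s := Finset.inf'_le _ hs

lemma exists_distTo_eq (S : Finset V) (hS : S.Nonempty) (v : V) :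
    ∃ s ∈ S, distTo Γ S hS v = Γ.dist v s := Finset.exists_mem_eq_inf' hS _

lemma distTo_le_add (hΓ : Γ.Connected) (S : Finset V) (hS : S.Nonempty) (v w : V) :
    distTo Γ S hS v ≤ distTo Γ S hS w + Γ.dist v w := by
  obtain ⟨s, hs, h⟩ := exists_distTo_eq (Γ := Γ) S hS w
  have h1 := distTo_le (Γ := Γ) S hS v hs
  have h2 : Γ.dist v s ≤ Γ.dist v w + Γ.dist w s := hΓ.dist_triangle
  omega

lemma distTo_eq_zero (S : Finset V) (hS : S.Nonempty) {s : V} (hs : s ∈ S) :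
    distTo Γ S hS s = 0 := by
  have := distTo_le (Γ := Γ) S hS s hs
  simpa using this

lemma isThreeLipschitz_distTo (hΓ : Γ.Connected) (S : Finset V) (hS : S.Nonempty) :
    IsThreeLipschitz Γ fun v => (distTo Γ S hS v : ℝ) := by
  intro x y
  have h1 := distTo_le_add hΓ S hS x y
  have h2 := distTo_le_add hΓ S hS y x
  rw [SimpleGraph.dist_comm] at h2
  have h1' : (distTo Γ S hS x : ℝ) ≤ distTo Γ S hS y + Γ.dist x y := by exact_mod_cast h1
  have h2' : (distTo Γ S hS y : ℝ) ≤ distTo Γ S hS x + Γ.dist x y := by exact_mod_cast h2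
  rw [abs_le]
  constructor <;> linarith [Nat.cast_nonneg (α := ℝ) (Γ.dist x y)]

/-- The parameter of a `3`-quasigeodesic sequence extends to a `3`-Lipschitz function. -/
lemma exists_parameter (hΓ : Γ.Connected) (c : ℕ → V) (n : ℕ)
    (hq : ∀ i j, i ≤ j → j ≤ n → j - i ≤ 3 * Γ.dist (c i) (c j)) :
    ∃ g : V → ℝ, IsThreeLipschitz Γ g ∧ ∀ i ≤ n, g (c i) = i := by
  -- McShane extension of c i ↦ i. The lower bound `hq` is exactly what prevents an earlier index
  -- from giving a value below i at c i.
  let g : V → ℕ := fun v => (Finset.range (n + 1)).inf' ⟨0, by simp⟩ fun i => i + 3 * Γ.dist (c i) v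
  have hle : ∀ v i, i ≤ n → g v ≤ i + 3 * Γ.dist (c i) v := fun v i hi =>
    Finset.inf'_le (fun i => i + 3 * Γ.dist (c i) v) (by simp; omega)
  have hex : ∀ v, ∃ i ≤ n, g v = i + 3 * Γ.dist (c i) v := fun v => by
    obtain ⟨i, hi, h⟩ := Finset.exists_mem_eq_inf' (s := Finset.range (n + 1)) ⟨0, by simp⟩
      fun i => i + 3 * Γ.dist (c i) v
    exact ⟨i, by simp at hi; omega, h⟩
  have hL : ∀ x y, g x ≤ g y + 3 * Γ.dist x y := fun x y => by
    obtain ⟨i, hi, h⟩ := hex y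
    have h1 := hle x i hi
    have h2 : Γ.dist (c i) x ≤ Γ.dist (c i) y + Γ.dist y x := hΓ.dist_triangle
    rw [Γ.dist_comm (u := y)] at h2
    omega
  refine ⟨fun v => g v, fun x y => ?_, fun i hi => ?_⟩
  · have h1 := hL x y
    have h2 := hL y x
    rw [Γ.dist_comm (u := y)] at h2
    have h1' : (g x : ℝ) ≤ g y + 3 * Γ.dist x y := by exact_mod_cast h1
    have h2' : (g y : ℝ) ≤ g x + 3 * Γ.dist x y := by exact_mod_cast h2
    rw [abs_le]
    constructor <;> linarith
  · obtain ⟨j, hj, h⟩ := hex (c i)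
    have h1 := hle (c i) i hi
    rw [Γ.dist_self] at h1
    have : g (c i) = i := by
      rcases le_total i j with hij | hij
      · omega
      · have := hq j i hij hi
        omega
    exact congrArg Nat.cast this

/-- Two vertices on a geodesic are joined by a geodesic inside it. -/
lemma exists_walk_support_subset {x y a b : V} (q : Γ.Walk x y) (hq : IsGeodesicWalk q)
    (ha : a ∈ q.support) (hb : b ∈ q.support) :
    ∃ p : Γ.Walk a b, p.length = Γ.dist a b ∧ p.support ⊆ q.support := by
  classical
  have hb' := hb
  rw [← q.take_spec ha, SimpleGraph.Walk.mem_support_append_iff] at hb'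
  rcases hb' with h | h
  · have hs := ((q.takeUntil a ha).isSubwalk_dropUntil h).trans (q.isSubwalk_takeUntil ha)
    refine ⟨((q.takeUntil a ha).dropUntil b h).reverse, ?_, ?_⟩
    · rw [SimpleGraph.Walk.length_reverse, SimpleGraph.length_eq_dist_of_subwalk hq hs,
        SimpleGraph.dist_comm]
    · intro z hz
      rw [SimpleGraph.Walk.support_reverse, List.mem_reverse] at hz
      exact hs.support_subset hz
  · have hs := ((q.dropUntil a ha).isSubwalk_takeUntil h).trans (q.isSubwalk_dropUntil ha)
    exact ⟨(q.dropUntil a ha).takeUntil b h, SimpleGraph.length_eq_dist_of_subwalk hq hs,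
      hs.support_subset⟩

/-- A vertex of a walk is no further from its endpoints than the length of the walk. -/
lemma dist_le_length_of_mem_support {x y a : V} (q : Γ.Walk x y) (ha : a ∈ q.support) :
    Γ.dist x a ≤ q.length := by
  classical
  exact (SimpleGraph.dist_le (q.takeUntil a ha)).trans (q.length_takeUntil_le_length ha)

/-- A function of height D that drops by at most one per step has area at least D²/2 below its
graph. -/
lemma sq_le_two_mul_sum_sub (D : ℕ) : D * D ≤ 2 * ∑ m ∈ Finset.range D, (D - m) := by
  induction D with
  | zero => simp
  | succ D ih =>
    rw [Finset.sum_range_succ']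
    simp only [Nat.add_sub_add_right, Nat.sub_zero]
    nlinarith

/-- In a graph with linear area, a `3`-quasigeodesic sequence stays uniformly close to any geodesic
with the same endpoints. -/
lemma HasLinearArea.distTo_geodesic_le (hΓ : Γ.Connected) {C : ℝ} (hC : 0 ≤ C)
    (hA : HasLinearArea Γ C)
    (c : ℕ → V) (n : ℕ) (hadj : ∀ k < n, Γ.Adj (c k) (c (k + 1)))
    (hq : ∀ i j, i ≤ j → j ≤ n → j - i ≤ 3 * Γ.dist (c i) (c j))
    (S : Finset V) (hS : S.Nonempty) (q : Γ.Walk (c 0) (c n)) (hgeo : IsGeodesicWalk q)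
    (hSq : ∀ a, a ∈ S ↔ a ∈ q.support) (i : ℕ) (hi : i ≤ n) :
    (distTo Γ S hS (c i) : ℝ) ≤ 56 * C := by
  classical
  have hstep : ∀ i j, i ≤ j → j ≤ n → Γ.dist (c i) (c j) ≤ j - i := by
    intro i j hij hj
    obtain ⟨p, hp, -⟩ := exists_walk_of_seq (Γ := Γ) c hij fun k h1 h2 => hadj k (by omega)
    exact hp ▸ SimpleGraph.dist_le p
  -- The worst point of the sequence; its distance D to the geodesic is to be bounded.
  obtain ⟨i0, hi0, hmax⟩ := Finset.exists_max_image (Finset.range (n + 1))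
    (fun i => distTo Γ S hS (c i)) ⟨0, by simp⟩
  simp only [Finset.mem_range, Nat.lt_succ_iff] at hi0 hmax
  set D := distTo Γ S hS (c i0) with hD
  refine (Nat.cast_le.2 (hmax i hi)).trans ?_
  have hS0 : c 0 ∈ S := (hSq _).2 q.start_mem_support
  have hSn : c n ∈ S := (hSq _).2 q.end_mem_support
  have hD0 : D ≤ i0 := (distTo_le S hS _ hS0).trans
    (by rw [SimpleGraph.dist_comm]; simpa using hstep 0 i0 (by omega) hi0)
  have hDn : D ≤ n - i0 := (distTo_le S hS _ hSn).trans (hstep i0 n hi0 le_rfl)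
  -- A parameter gap of 6D forces distance at least 2D, so a connection of length at most D from
  -- there to the geodesic stays D away from c i0. If the window is cut off at an end of the
  -- sequence, that end lies on the geodesic and the connection is trivial.
  obtain ⟨i1, hi1⟩ : ∃ i1, i1 = i0 - 6 * D := ⟨_, rfl⟩
  obtain ⟨i2, hi2⟩ : ∃ i2, i2 = min n (i0 + 6 * D) := ⟨_, rfl⟩
  obtain ⟨y, hy, hyd⟩ := exists_distTo_eq (Γ := Γ) S hS (c i1)
  obtain ⟨w, hw, hwd⟩ := exists_distTo_eq (Γ := Γ) S hS (c i2)
  have hy1 : Γ.dist (c i1) y ≤ D := hyd ▸ hmax i1 (by omega)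
  have hw1 : Γ.dist (c i2) w ≤ D := hwd ▸ hmax i2 (by omega)
  obtain ⟨P', hPl', -, hPI'⟩ := exists_walk_of_seq (Γ := Γ) c (i := i1) (j := i2) (by omega)
    fun k h1 h2 => hadj k (by omega)
  obtain ⟨A, hAl⟩ := hΓ.exists_walk_length_eq_dist (c i2) w
  obtain ⟨E, hEl⟩ := hΓ.exists_walk_length_eq_dist (c i1) y
  obtain ⟨B, hBl, hBs⟩ := exists_walk_support_subset q hgeo ((hSq _).1 hw) ((hSq _).1 hy)
  -- The return path: down to the geodesic, along it, and back up. The function f vanishes on it, so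
  -- only the sequence contributes to the integral.
  set T := A.append (B.append E.reverse) with hT
  have hQ : T.support.toFinset.Nonempty := ⟨c i2, by simp⟩
  set f : V → ℕ := distTo Γ T.support.toFinset hQ with hf
  have hfT : ∀ a ∈ T.support, ((f a : ℕ) : ℝ) = 0 := fun a ha => by
    rw [hf, distTo_eq_zero _ _ (by simpa using ha)]; simp
  -- Each step of the sequence raises g by 1, so the integral becomes the plain sum of the values of
  -- f.
  obtain ⟨g, hgL, hg⟩ := exists_parameter hΓ c n hq
  have hI := hA (fun v => (f v : ℝ)) g (isThreeLipschitz_distTo hΓ _ hQ) hgL _ (P'.append T)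
  rw [lineIntegral_append, lineIntegral_eq_zero _ g T hfT, add_zero, hPI'] at hI
  have hI2 : ∑ k ∈ Finset.range (i2 - i1),
      (f (c (i1 + k)) : ℝ) * (g (c (i1 + k + 1)) - g (c (i1 + k))) =
      ((∑ k ∈ Finset.range (i2 - i1), f (c (i1 + k)) : ℕ) : ℝ) := by
    push_cast
    refine Finset.sum_congr rfl fun k hk => ?_
    rw [Finset.mem_range] at hk
    rw [hg _ (by omega), hg _ (by omega)]
    push_cast
    ring
  rw [hI2] at hI
  have hfi0 : D ≤ f (c i0) := by
    obtain ⟨a, ha, hfa⟩ := exists_distTo_eq (Γ := Γ) T.support.toFinset hQ (c i0)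
    rw [hf, hfa]
    simp only [hT, List.mem_toFinset, SimpleGraph.Walk.mem_support_append_iff,
      SimpleGraph.Walk.support_reverse, List.mem_reverse] at ha
    have hconn : ∀ j z, (c j ∈ S ∨ 2 * D ≤ Γ.dist (c i0) (c j)) → j ≤ n →
        ∀ X : Γ.Walk (c j) z, X.length = distTo Γ S hS (c j) → a ∈ X.support →
          D ≤ Γ.dist (c i0) a := by
      intro j z hj hjn X hX haX
      have h1 := dist_le_length_of_mem_support X haX
      rw [hX] at h1
      rcases hj with hj | hj
      · rw [distTo_eq_zero S hS hj, Nat.le_zero, hΓ.dist_eq_zero_iff] at h1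
        exact h1 ▸ distTo_le S hS _ hj
      · have h2 := hmax j hjn
        have h3 : Γ.dist (c i0) (c j) ≤ Γ.dist (c i0) a + Γ.dist a (c j) := hΓ.dist_triangle
        rw [Γ.dist_comm (u := a)] at h3
        omega
    rcases ha with ha | ha | ha
    · refine hconn i2 w ?_ (by omega) A (hAl.trans hwd.symm) ha
      rcases le_total n (i0 + 6 * D) with h | h
      · left
        rwa [hi2, min_eq_left h]
      · right
        have := hq i0 i2 (by omega) (by omega)
        omega
    · exact distTo_le S hS _ ((hSq _).2 (hBs ha))
    · refine hconn i1 y ?_ (by omega) E (hEl.trans hyd.symm) ha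
      rcases le_total i0 (6 * D) with h | h
      · left
        rwa [hi1, Nat.sub_eq_zero_of_le h]
      · right
        have := hq i1 i0 (by omega) (by omega)
        rw [SimpleGraph.dist_comm]
        omega
  have hfk : ∀ m < D, D - m ≤ f (c (i0 + m)) := fun m hm => by
    have h1 := distTo_le_add hΓ T.support.toFinset hQ (c i0) (c (i0 + m))
    change f (c i0) ≤ f (c (i0 + m)) + _ at h1
    have h2 := hstep i0 (i0 + m) (by omega) (by omega)
    omega
  have hsum : D * D ≤ 2 * ∑ k ∈ Finset.range (i2 - i1), f (c (i1 + k)) := by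
    refine (sq_le_two_mul_sum_sub D).trans (Nat.mul_le_mul_left 2 ?_)
    calc ∑ m ∈ Finset.range D, (D - m) ≤ ∑ m ∈ Finset.range D, f (c (i0 + m)) :=
          Finset.sum_le_sum fun m hm => hfk m (Finset.mem_range.1 hm)
      _ = ∑ k ∈ (Finset.range D).map (addLeftEmbedding (i0 - i1)), f (c (i1 + k)) := by
          rw [Finset.sum_map]
          refine Finset.sum_congr rfl fun m _ => ?_
          congr 2
          simp only [addLeftEmbedding_apply]
          omega
      _ ≤ _ := by
          refine Finset.sum_le_sum_of_subset fun k hk => ?_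
          simp only [Finset.mem_map, Finset.mem_range, addLeftEmbedding_apply] at hk ⊢
          obtain ⟨m, hm, rfl⟩ := hk
          omega
  -- At most 12D for the window, D for each connection, and 14D along the geodesic.
  have hlen : (P'.append T).length ≤ 28 * D := by
    have h1 : Γ.dist w y ≤ Γ.dist w (c i2) + Γ.dist (c i2) y := hΓ.dist_triangle
    have h2 : Γ.dist (c i2) y ≤ Γ.dist (c i2) (c i1) + Γ.dist (c i1) y := hΓ.dist_triangle
    have h3 := hstep i1 i2 (by omega) (by omega)
    rw [SimpleGraph.dist_comm] at h3
    rw [Γ.dist_comm (u := w) (v := c i2)] at h1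
    simp only [hT, SimpleGraph.Walk.length_append, SimpleGraph.Walk.length_reverse]
    omega
  have h1 : ((D * D : ℕ) : ℝ) ≤ ((2 * ∑ k ∈ Finset.range (i2 - i1), f (c (i1 + k)) : ℕ) : ℝ) :=
    Nat.cast_le.2 hsum
  have h2 : ((P'.append T).length : ℝ) ≤ 28 * D := by exact_mod_cast hlen
  have h3 := (le_abs_self _).trans hI
  have h4 := mul_le_mul_of_nonneg_left h2 hC
  rw [Nat.cast_mul, Nat.cast_mul] at h1
  rcases Nat.eq_zero_or_pos D with h0 | h0
  · rw [h0]; simpa using hC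
  · have : (0 : ℝ) < D := by exact_mod_cast h0
    refine le_of_mul_le_mul_right ?_ this
    push_cast at h1 h3
    linarith

/-- In a graph with linear area, let `y'` be a point of a geodesic nearest to `y`. The part of the
geodesic before `y'` is uniformly close to any geodesic from its origin to `y`. -/
lemma HasLinearArea.close_of_nearest (hΓ : Γ.Connected) {C : ℝ} (hC : 0 ≤ C)
    (hA : HasLinearArea Γ C) {x y y' : V} (r : Γ.Walk x y') (hr : IsGeodesicWalk r)
    (hy : ∀ a ∈ r.support, Γ.dist y y' ≤ Γ.dist y a) (p : Γ.Walk x y) (hp : IsGeodesicWalk p)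
    (a : V) (ha : a ∈ r.support) : ∃ b ∈ p.support, (Γ.dist a b : ℝ) ≤ 56 * C := by
  classical
  obtain ⟨s, hs⟩ := hΓ.exists_walk_length_eq_dist y' y
  set t := r.append s with ht
  have hdist : ∀ {u v : V} (w : Γ.Walk u v), IsGeodesicWalk w → ∀ i j, i ≤ j → j ≤ w.length →
      Γ.dist (w.getVert i) (w.getVert j) = j - i := by
    intro u v w hw i j hij hj
    have h1 := SimpleGraph.length_eq_dist_of_subwalk hw
      (((w.take j).isSubwalk_drop i).trans (w.isSubwalk_take j))
    rw [SimpleGraph.Walk.drop_length, SimpleGraph.Walk.take_length, SimpleGraph.Walk.take_getVert,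
      min_eq_left hj, min_eq_right hij] at h1
    exact h1.symm
  -- Only u on r and v on s need an argument. Minimality of y' gives d(v,y') ≤ d(u,v), hence d(u,y')
  -- ≤ 2d(u,v), and the two add up to 3d(u,v).
  have hq : ∀ i j, i ≤ j → j ≤ t.length → j - i ≤ 3 * Γ.dist (t.getVert i) (t.getVert j) := by
    intro i j hij hj
    have hlt : t.length = r.length + s.length := by simp [ht]
    rw [ht, SimpleGraph.Walk.getVert_append', SimpleGraph.Walk.getVert_append']
    rcases le_or_gt j r.length with h1 | h1
    · rw [if_pos (by omega), if_pos h1, hdist r hr i j hij h1]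
      omega
    · rw [if_neg (by omega : ¬ j ≤ r.length)]
      rcases le_or_gt i r.length with h2 | h2
      · rw [if_pos h2]
        have e1 := hdist r hr i r.length h2 le_rfl
        have e2 := hdist s hs 0 (j - r.length) (by omega) (by omega)
        have e3 := hdist s hs (j - r.length) s.length (by omega) le_rfl
        have e4 := hdist s hs 0 s.length (by omega) le_rfl
        rw [r.getVert_length] at e1
        rw [s.getVert_zero] at e2 e4
        rw [s.getVert_length] at e3 e4
        set u := r.getVert i with hu
        set v := s.getVert (j - r.length) with hv
        have e5 := hy u (r.getVert_mem_support i)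
        have e6 : Γ.dist y u ≤ Γ.dist y v + Γ.dist v u := hΓ.dist_triangle
        have e7 : Γ.dist u y' ≤ Γ.dist u v + Γ.dist v y' := hΓ.dist_triangle
        rw [Γ.dist_comm (u := y) (v := y')] at e5
        rw [Γ.dist_comm (u := y) (v := v), Γ.dist_comm (u := v) (v := u)] at e6
        rw [Γ.dist_comm (u := v) (v := y')] at e7
        omega
      · rw [if_neg (by omega : ¬ i ≤ r.length), hdist s hs _ _ (by omega) (by omega)]
        omega
  have hends : t.getVert 0 = x ∧ t.getVert t.length = y := by simp
  obtain ⟨i, hi, hil⟩ := SimpleGraph.Walk.mem_support_iff_exists_getVert.1 ha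
  have hai : t.getVert i = a := by
    rw [ht, SimpleGraph.Walk.getVert_append', if_pos hil, hi]
  have key := hA.distTo_geodesic_le hΓ hC t.getVert t.length (fun k hk => t.adj_getVert_succ hk) hq
    p.support.toFinset ⟨x, by simp⟩ (p.copy hends.1.symm hends.2.symm)
    (by rw [IsGeodesicWalk, SimpleGraph.Walk.length_copy, hends.1, hends.2]; exact hp) (by simp)
    i (by rw [ht, SimpleGraph.Walk.length_append]; omega)
  obtain ⟨b, hb, hbd⟩ := exists_distTo_eq (Γ := Γ) p.support.toFinset ⟨x, by simp⟩ (t.getVert i)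
  rw [hbd, hai] at key
  exact ⟨b, by simpa using hb, key⟩

lemma IsGeodesicWalk.reverse {x y : V} {p : Γ.Walk x y} (hp : IsGeodesicWalk p) :
    IsGeodesicWalk p.reverse := by
  rw [IsGeodesicWalk, SimpleGraph.Walk.length_reverse, SimpleGraph.dist_comm]
  exact hp

/-- A connected graph with linear area is hyperbolic. -/
theorem HasLinearArea.isHyperbolicGraph (hΓ : Γ.Connected) {C : ℝ} (hC : 0 ≤ C)
    (hA : HasLinearArea Γ C) : IsHyperbolicGraph Γ := by
  classical
  refine ⟨hΓ, ⌊56 * C⌋₊, fun x y z p q r hp hq hr a ha => ?_⟩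
  -- The projection of y splits r into two parts, the first close to p and the second, after
  -- reversal, close to q.
  obtain ⟨y', hy', hyd⟩ := exists_distTo_eq (Γ := Γ) r.support.toFinset ⟨x, by simp⟩ y
  have hmin : ∀ b ∈ r.support, Γ.dist y y' ≤ Γ.dist y b := fun b hb =>
    hyd ▸ distTo_le _ _ _ (by simpa using hb)
  rw [List.mem_toFinset] at hy'
  have ha' := ha
  rw [← r.take_spec hy', SimpleGraph.Walk.mem_support_append_iff] at ha'
  rcases ha' with h | h
  · obtain ⟨b, hb, hd⟩ := hA.close_of_nearest hΓ hC (r.takeUntil y' hy')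
      (SimpleGraph.length_eq_dist_of_subwalk hr (r.isSubwalk_takeUntil hy'))
      (fun b hb => hmin b (r.support_takeUntil_subset_support hy' hb)) p hp a h
    exact ⟨b, .inl hb, Nat.le_floor hd⟩
  · obtain ⟨b, hb, hd⟩ := hA.close_of_nearest hΓ hC (r.dropUntil y' hy').reverse
      (IsGeodesicWalk.reverse
        (SimpleGraph.length_eq_dist_of_subwalk hr (r.isSubwalk_dropUntil hy')))
      (fun b hb => hmin b (r.support_dropUntil_subset_support hy' (by simpa using hb)))
      q.reverse hq.reverse a (by simpa using h)
    exact ⟨b, .inr (by simpa using hb), Nat.le_floor hd⟩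

end LineIntegral

/-! ### Shortcuts in hyperbolic graphs -/

section Shortcut

variable {V : Type*} {Γ : SimpleGraph V}

/-- Geodesic triangles are `δ`-slim. -/
def IsSlim (Γ : SimpleGraph V) (δ : ℕ) : Prop :=
  ∀ (x y z : V) (p : Γ.Walk x y) (q : Γ.Walk y z) (r : Γ.Walk x z),
    IsGeodesicWalk p → IsGeodesicWalk q → IsGeodesicWalk r →
      ∀ a ∈ r.support, ∃ b : V, (b ∈ p.support ∨ b ∈ q.support) ∧ Γ.dist a b ≤ δ

lemma dist_add_dist_le_length {x y a : V} (q : Γ.Walk x y) (ha : a ∈ q.support) :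
    Γ.dist x a + Γ.dist a y ≤ q.length := by
  classical
  have h := congrArg SimpleGraph.Walk.length (q.take_spec ha)
  rw [SimpleGraph.Walk.length_append] at h
  have h1 := SimpleGraph.dist_le (q.takeUntil a ha)
  have h2 := SimpleGraph.dist_le (q.dropUntil a ha)
  omega

/-- A long closed sequence in a hyperbolic graph has a short subsequence that is not geodesic. -/
lemma IsSlim.exists_shortcut (hΓ : Γ.Connected) {δ : ℕ} (hδ : IsSlim Γ δ) (c : ℕ → V) (n : ℕ)
    (hn : 4 * δ + 4 ≤ n) (hc : c 0 = c n) (hstep : ∀ k < n, Γ.dist (c k) (c (k + 1)) ≤ 1) :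
    ∃ i j, i < j ∧ j ≤ n ∧ j - i ≤ 4 * δ + 4 ∧ Γ.dist (c i) (c j) < j - i := by
  by_contra! hcon
  have hadj : ∀ k < n, Γ.Adj (c k) (c (k + 1)) := fun k hk => by
    have h1 := hcon k (k + 1) (by omega) hk (by omega)
    have h2 := hstep k hk
    rw [← SimpleGraph.dist_eq_one_iff_adj]
    omega
  have hle : ∀ i j, i ≤ j → j ≤ n → Γ.dist (c i) (c j) ≤ j - i := fun i j hij hj => by
    obtain ⟨p, hp, -⟩ := exists_walk_of_seq (Γ := Γ) c hij fun k _ _ => hadj k (by omega)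
    exact hp ▸ SimpleGraph.dist_le p
  -- The point farthest from c 0. It is at least 2δ+2 steps from both ends, because the initial and
  -- final segments are geodesic for that long.
  obtain ⟨t, ht, hmax⟩ := Finset.exists_max_image (Finset.range (n + 1))
    (fun i => Γ.dist (c 0) (c i)) ⟨0, by simp⟩
  simp only [Finset.mem_range, Nat.lt_succ_iff] at ht hmax
  have ht1 : 2 * δ + 2 ≤ t := by
    have h1 := hcon 0 (2 * δ + 2) (by omega) (by omega) (by omega)
    have h2 := hmax (2 * δ + 2) (by omega)
    have h3 := hle 0 t (by omega) ht
    omega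
  have ht2 : 2 * δ + 2 ≤ n - t := by
    have h1 := hcon (n - (2 * δ + 2)) n (by omega) (by omega) (by omega)
    have h2 := hmax (n - (2 * δ + 2)) (by omega)
    have h3 := hle t n ht le_rfl
    rw [← hc, SimpleGraph.dist_comm] at h1 h3
    omega
  obtain ⟨i, rfl⟩ := Nat.exists_eq_add_of_le (show 2 * δ + 1 ≤ t by omega)
  obtain ⟨r, hr, hrs, -⟩ := exists_walk_of_seq (Γ := Γ) c
    (show i ≤ 2 * δ + 1 + i + (2 * δ + 1) by omega) fun k _ _ => hadj k (by omega)
  obtain ⟨p, hp⟩ := hΓ.exists_walk_length_eq_dist (c i) (c 0)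
  obtain ⟨q, hq⟩ := hΓ.exists_walk_length_eq_dist (c 0) (c (2 * δ + 1 + i + (2 * δ + 1)))
  have hrg : IsGeodesicWalk r := by
    have h1 := hcon i (2 * δ + 1 + i + (2 * δ + 1)) (by omega) (by omega) (by omega)
    have h2 := SimpleGraph.dist_le r
    rw [IsGeodesicWalk]
    omega
  have hmem : c (2 * δ + 1 + i) ∈ r.support := by
    have := hrs (2 * δ + 1) (by omega)
    rwa [add_comm i] at this
  obtain ⟨b, hb, hbd⟩ := hδ _ _ _ p q r hp hq hrg _ hmem
  set x := c (2 * δ + 1 + i)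
  -- If b lies on a geodesic from c 0 to c j and within δ of x, then d(b, c j) ≥ δ+1. So d(c 0, x) ≤
  -- d(c 0, b) + δ < d(c 0, c j), against the choice of x.
  have main : ∀ j ≤ n, 2 * δ + 1 ≤ Γ.dist (c j) x →
      Γ.dist (c 0) b + Γ.dist b (c j) ≤ Γ.dist (c 0) (c j) → False := by
    intro j hj hjx hbj
    have h1 := hmax j hj
    have h2 : Γ.dist (c 0) x ≤ Γ.dist (c 0) b + Γ.dist b x := hΓ.dist_triangle
    have h3 : Γ.dist (c j) x ≤ Γ.dist (c j) b + Γ.dist b x := hΓ.dist_triangle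
    rw [Γ.dist_comm (u := b) (v := x)] at h2 h3
    rw [Γ.dist_comm (u := c j) (v := b)] at h3
    omega
  rcases hb with hb | hb
  · have h1 := hcon i (2 * δ + 1 + i) (by omega) (by omega) (by omega)
    change _ ≤ Γ.dist _ x at h1
    refine main i (by omega) (by omega) ?_
    have h2 := dist_add_dist_le_length p hb
    rw [hp] at h2
    rw [Γ.dist_comm (u := c 0) (v := b), Γ.dist_comm (u := b) (v := c i),
      Γ.dist_comm (u := c 0) (v := c i)]
    omega
  · have h1 := hcon (2 * δ + 1 + i) (2 * δ + 1 + i + (2 * δ + 1)) (by omega) (by omega) (by omega)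
    refine main (2 * δ + 1 + i + (2 * δ + 1)) (by omega) ?_ ?_
    · rw [SimpleGraph.dist_comm]
      change _ ≤ Γ.dist x _ at h1
      omega
    · exact hq ▸ dist_add_dist_le_length q hb

/-- A long closed walk in a hyperbolic graph has a short subwalk that is not geodesic. -/
lemma IsSlim.exists_subwalk (hΓ : Γ.Connected) {δ : ℕ} (hδ : IsSlim Γ δ) {v : V} (w : Γ.Walk v v)
    (hw : 4 * δ + 4 ≤ w.length) :
    ∃ (a b : V) (p₁ : Γ.Walk v a) (p₂ : Γ.Walk a b) (p₃ : Γ.Walk b v),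
      w = p₁.append (p₂.append p₃) ∧ p₂.length ≤ 4 * δ + 4 ∧ Γ.dist a b < p₂.length := by
  obtain ⟨i, j, hij, hj, hN, hd⟩ := hδ.exists_shortcut hΓ w.getVert w.length hw (by simp)
    fun k hk => (SimpleGraph.dist_eq_one_iff_adj.2 (w.adj_getVert_succ hk)).le
  refine ⟨_, _, w.take i, (w.drop i).take (j - i), (w.drop i).drop (j - i), ?_, ?_, ?_⟩
  · rw [SimpleGraph.Walk.append_take_drop_eq, SimpleGraph.Walk.append_take_drop_eq]
  · rw [SimpleGraph.Walk.take_length]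
    omega
  · rw [SimpleGraph.Walk.take_length, SimpleGraph.Walk.drop_length, SimpleGraph.Walk.drop_getVert,
      Nat.add_sub_cancel' hij.le]
    omega

end Shortcut

universe u v

/-! ### Actions with compact open stabilizers -/

section Action

variable {G : Type u} [Group G] {V : Type v} [MulAction G V]

lemma setOf_smul_eq_image {x y : V} {g₀ : G} (h : g₀ • x = y) :
    {g : G | g • x = y} = (g₀ * ·) '' (MulAction.stabilizer G x : Set G) := by
  ext g
  simp only [Set.mem_ofPred_eq, Set.image_mul_left, Set.mem_preimage, SetLike.mem_coe,
    MulAction.mem_stabilizer_iff, mul_smul, inv_smul_eq_iff, h]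

variable [TopologicalSpace G] [IsTopologicalGroup G]

lemma isOpen_setOf_smul_eq {x : V} (hx : IsOpen (MulAction.stabilizer G x : Set G)) (y : V) :
    IsOpen {g : G | g • x = y} := by
  by_cases h : ∃ g₀ : G, g₀ • x = y
  · obtain ⟨g₀, h⟩ := h
    rw [setOf_smul_eq_image h]
    exact isOpenMap_mul_left g₀ _ hx
  · push Not at h
    simp [h]

lemma isCompact_setOf_smul_eq {x : V} (hx : IsCompact (MulAction.stabilizer G x : Set G)) (y : V) :
    IsCompact {g : G | g • x = y} := by
  by_cases h : ∃ g₀ : G, g₀ • x = y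
  · obtain ⟨g₀, h⟩ := h
    rw [setOf_smul_eq_image h]
    exact hx.image (continuous_const_mul g₀)
  · push Not at h
    simp [h]

/-- Compact sets have finite orbits on points with open stabilizer. -/
lemma finite_image_smul {x : V} (hx : IsOpen (MulAction.stabilizer G x : Set G)) {S : Set G}
    (hS : IsCompact S) : ((fun g : G => g • x) '' S).Finite := by
  -- With the discrete topology on the orbit space, openness of the stabilizer is continuity of the
  -- orbit map, and compact images are finite.
  let _ : TopologicalSpace V := ⊥
  have : DiscreteTopology V := ⟨rfl⟩
  have hc : Continuous fun g : G => g • x := by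
    rw [continuous_discrete_rng]
    exact fun y => isOpen_setOf_smul_eq hx y
  exact (hS.image hc).finite_of_discrete

end Action

/-! ### Isometric action on a Cayley-Abels graph -/

section CayleyAbels

variable {G : Type u} [Group G] [TopologicalSpace G] {V : Type v} [MulAction G V]
  {Γ : SimpleGraph V}

lemma IsCayleyAbelsGraph.dist_smul (h : IsCayleyAbelsGraph G Γ) (g : G) (x y : V) :
    Γ.dist (g • x) (g • y) = Γ.dist x y := by
  have key : ∀ (g : G) (x y : V), Γ.dist (g • x) (g • y) ≤ Γ.dist x y := fun g x y => by
    obtain ⟨p, hp⟩ := h.connected.exists_walk_length_eq_dist x y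
    let F : Γ →g Γ := ⟨fun z => g • z, fun {a b} hab => h.adj_smul g a b hab⟩
    have := SimpleGraph.dist_le (p.map F)
    rw [SimpleGraph.Walk.length_map, hp] at this
    exact this
  refine le_antisymm (key g x y) ?_
  simpa using key g⁻¹ (g • x) (g • y)

lemma IsCayleyAbelsGraph.finite_ball (h : IsCayleyAbelsGraph G Γ) (x : V) (n : ℕ) :
    {y | Γ.dist x y ≤ n}.Finite := by
  induction n with
  | zero =>
    refine (Set.finite_singleton x).subset fun y hy => ?_
    simp only [Set.mem_ofPred_eq, Nat.le_zero, h.connected.dist_eq_zero_iff] at hy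
    exact hy.symm
  | succ n ih =>
    refine (ih.biUnion fun y _ => (h.locallyFinite y).union (Set.finite_singleton y)).subset ?_
    intro z hz
    obtain ⟨p, hp⟩ := h.connected.exists_walk_length_eq_dist x z
    simp only [Set.mem_ofPred_eq] at hz
    simp only [Set.mem_iUnion]
    refine ⟨p.getVert n, ?_, ?_⟩
    · have := SimpleGraph.dist_le (p.take n)
      rw [SimpleGraph.Walk.take_length] at this
      simp only [Set.mem_ofPred_eq]
      omega
    · have := SimpleGraph.dist_le (p.drop n)
      rw [SimpleGraph.Walk.drop_length] at this
      rcases Nat.eq_zero_or_pos (Γ.dist (p.getVert n) z) with h0 | h0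
      · right
        rw [h.connected.dist_eq_zero_iff] at h0
        exact h0.symm
      · left
        exact SimpleGraph.dist_eq_one_iff_adj.1 (by omega)

/-- Elements displacing the base vertex by at most `m + 1` are products of exactly `m + 1` elements
displacing it by at most `1`. -/
lemma IsCayleyAbelsGraph.exists_list (hΓ : IsCayleyAbelsGraph G Γ) (x : V) (m : ℕ) (g : G)
    (hg : Γ.dist x (g • x) ≤ m + 1) :
    ∃ l : List G, l.length = m + 1 ∧ (∀ k ∈ l, Γ.dist x (k • x) ≤ 1) ∧ l.prod = g := by
  induction m generalizing g with
  | zero => exact ⟨[g], rfl, by simpa using hg, by simp⟩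
  | succ m ih =>
    obtain ⟨p, hp⟩ := hΓ.connected.exists_walk_length_eq_dist x (g • x)
    obtain ⟨g', hg'⟩ := hΓ.transitive x (p.getVert (m + 1))
    have h1 := SimpleGraph.dist_le (p.take (m + 1))
    have h2 := SimpleGraph.dist_le (p.drop (m + 1))
    rw [SimpleGraph.Walk.take_length, ← hg'] at h1
    rw [SimpleGraph.Walk.drop_length, ← hg'] at h2
    obtain ⟨l, hl, hlK, hlp⟩ := ih g' (by omega)
    refine ⟨l ++ [g'⁻¹ * g], by simp [hl], fun k hk => ?_, by simp [hlp]⟩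
    rw [List.mem_append, List.mem_singleton] at hk
    rcases hk with hk | rfl
    · exact hlK k hk
    · rw [← hΓ.dist_smul g' x, smul_smul, mul_inv_cancel_left]
      omega

end CayleyAbels

/-! ### Hyperbolic groups are compactly presented -/

section Presentation

variable {G : Type u} [Group G] [TopologicalSpace G] [IsTopologicalGroup G]
  {V : Type v} [MulAction G V] {Γ : SimpleGraph V}

/-- Dehn's algorithm: the generators move a base vertex by at most 1, the relators are all short
words trivial in the group, and any longer trivial word contains a subword replaceable by a shorter
one modulo a relator. -/
theorem IsCayleyAbelsGraph.isCompactlyPresented (hΓ : IsCayleyAbelsGraph G Γ) {δ : ℕ}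
    (hδ : IsSlim Γ δ) : IsCompactlyPresented G := by
  classical
  obtain ⟨x⟩ := hΓ.connected.nonempty
  set K : Set G := {g | Γ.dist x (g • x) ≤ 1} with hK
  set φ := FreeGroup.lift (fun k : K => (k : G)) with hφ
  set R : Set (FreeGroup K) := {r | φ r = 1 ∧ ∃ w : List (K × Bool), FreeGroup.mk w = r ∧
    w.length ≤ 2 * (4 * δ + 5)} with hR
  have hKc : IsCompact K := by
    have : K = ⋃ y ∈ {y | Γ.dist x y ≤ 1}, {g : G | g • x = y} := by
      ext g
      simp [hK]
    rw [this]
    exact (hΓ.finite_ball x 1).isCompact_biUnion fun y _ =>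
      isCompact_setOf_smul_eq (hΓ.isCompact_stabilizer x) y
  have hword : ∀ (m : ℕ) (g : G), Γ.dist x (g • x) ≤ m + 1 →
      ∃ w : List (K × Bool), w.length = m + 1 ∧ φ (FreeGroup.mk w) = g := by
    intro m g hg
    obtain ⟨l, hl, hlK, hlp⟩ := hΓ.exists_list x m g hg
    refine ⟨l.attach.map fun k => (⟨k.1, hlK k.1 k.2⟩, true), by simp [hl], ?_⟩
    rw [hφ, FreeGroup.lift_mk, List.map_map]
    simpa [Function.comp_def] using hlp
  refine ⟨K, hKc, R, ⟨2 * (4 * δ + 5), fun r hr => hr.2⟩, fun g => ?_, le_antisymm ?_ ?_⟩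
  · obtain ⟨w, -, hw⟩ := hword (Γ.dist x (g • x)) g (by omega)
    exact ⟨_, hw⟩
  · have main : ∀ (n : ℕ) (l : List (K × Bool)), l.length = n → φ (FreeGroup.mk l) = 1 →
        FreeGroup.mk l ∈ Subgroup.normalClosure R := by
      intro n
      induction n using Nat.strong_induction_on with
      | _ n ih =>
      intro l hln hl
      by_cases hn : n ≤ 2 * (4 * δ + 5)
      · exact Subgroup.subset_normalClosure ⟨hl, l, rfl, by omega⟩
      let c : ℕ → V := fun i => φ (FreeGroup.mk (l.take i)) • x
      have hsplit : ∀ i j, i ≤ j → φ (FreeGroup.mk (l.take j)) =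
          φ (FreeGroup.mk (l.take i)) * φ (FreeGroup.mk ((l.drop i).take (j - i))) := by
        intro i j hij
        rw [← map_mul, FreeGroup.mul_mk, ← List.take_add, Nat.add_sub_cancel' hij]
      have hdist : ∀ i j, i ≤ j → Γ.dist (c i) (c j) =
          Γ.dist x (φ (FreeGroup.mk ((l.drop i).take (j - i))) • x) := by
        intro i j hij
        simp only [c]
        rw [hsplit i j hij, mul_smul, hΓ.dist_smul]
      have hletter : ∀ k : K × Bool, Γ.dist x (φ (FreeGroup.mk [k]) • x) ≤ 1 := by
        rintro ⟨⟨k, hk⟩, b⟩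
        rw [hφ, FreeGroup.lift_mk]
        cases b
        · have h1 : Γ.dist x (k • x) ≤ 1 := hk
          rw [← hΓ.dist_smul k⁻¹, inv_smul_smul, SimpleGraph.dist_comm] at h1
          simpa using h1
        · simpa using! hk
      have hstep : ∀ k < n, Γ.dist (c k) (c (k + 1)) ≤ 1 := by
        intro k hk
        rw [hdist k (k + 1) (by omega), Nat.add_sub_cancel_left]
        rw [List.take_one_drop_eq_of_lt_length (by omega)]
        exact hletter _
      have hc : c 0 = c n := by
        simp only [c]
        rw [← hln, List.take_length, hl, List.take_zero, ← FreeGroup.one_eq_mk, map_one]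
      -- `hword` always spends at least one letter, even on an element fixing x. A segment of one
      -- letter therefore cannot be shortened and is first enlarged by a neighbouring letter, which
      -- accounts for 4δ+5.
      obtain ⟨i, j, hij, hjn, hjN, hd⟩ : ∃ i j, i + 2 ≤ j ∧ j ≤ n ∧ j - i ≤ 4 * δ + 5 ∧
          Γ.dist (c i) (c j) < j - i := by
        obtain ⟨i, j, hij, hjn, hjN, hd⟩ := hδ.exists_shortcut hΓ.connected c n (by omega) hc hstep
        rcases Nat.lt_or_ge (i + 1) j with h | h
        · exact ⟨i, j, h, hjn, by omega, hd⟩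
        · obtain rfl : j = i + 1 := by omega
          rcases Nat.lt_or_ge (i + 1) n with h | h
          · have h1 := hstep (i + 1) h
            have h2 : Γ.dist (c i) (c (i + 1 + 1)) ≤ Γ.dist (c i) (c (i + 1)) +
              Γ.dist (c (i + 1)) (c (i + 1 + 1)) := hΓ.connected.dist_triangle
            exact ⟨i, i + 1 + 1, by omega, by omega, by omega, by omega⟩
          · obtain ⟨i, rfl⟩ : ∃ i', i = i' + 1 := ⟨i - 1, by omega⟩
            have h1 := hstep i (by omega)
            have h2 : Γ.dist (c i) (c (i + 1 + 1)) ≤ Γ.dist (c i) (c (i + 1)) +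
              Γ.dist (c (i + 1)) (c (i + 1 + 1)) := hΓ.connected.dist_triangle
            exact ⟨i, i + 1 + 1, by omega, by omega, by omega, by omega⟩
      set A := l.take i
      set B := (l.drop i).take (j - i) with hB
      set C := l.drop j with hC
      have hl' : l = A ++ (B ++ C) := by
        have : C = (l.drop i).drop (j - i) := by
          rw [List.drop_drop, Nat.add_sub_cancel' (by omega)]
        rw [this, List.take_append_drop, List.take_append_drop]
      have hBl : B.length = j - i := by
        rw [hB, List.length_take, List.length_drop]
        omega
      rw [hdist i j (by omega)] at hd
      change Γ.dist x (φ (FreeGroup.mk B) • x) < _ at hd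
      obtain ⟨B', hB'l, hB'⟩ := hword (j - i - 2) (φ (FreeGroup.mk B)) (by omega)
      have hrel : FreeGroup.mk B * (FreeGroup.mk B')⁻¹ ∈ R := by
        refine ⟨by rw [map_mul, map_inv, hB', mul_inv_cancel], B ++ FreeGroup.invRev B', ?_, ?_⟩
        · rw [FreeGroup.inv_mk, FreeGroup.mul_mk]
        · rw [List.length_append, FreeGroup.invRev_length]
          omega
      have heq : FreeGroup.mk l = FreeGroup.mk A * (FreeGroup.mk B * (FreeGroup.mk B')⁻¹) *
          (FreeGroup.mk A)⁻¹ * FreeGroup.mk (A ++ (B' ++ C)) := by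
        rw [hl', ← FreeGroup.mul_mk, ← FreeGroup.mul_mk, ← FreeGroup.mul_mk, ← FreeGroup.mul_mk]
        group
      have hlen : l.length = A.length + (B.length + C.length) := by
        rw [← List.length_append, ← List.length_append, ← hl']
      have hker : φ (FreeGroup.mk (A ++ (B' ++ C))) = 1 := by
        rw [← FreeGroup.mul_mk, ← FreeGroup.mul_mk, map_mul, map_mul, hB', ← map_mul, ← map_mul,
          FreeGroup.mul_mk, FreeGroup.mul_mk, ← hl', hl]
      rw [heq]
      refine mul_mem (Subgroup.normalClosure_normal.conj_mem _
        (Subgroup.subset_normalClosure hrel) _) (ih _ ?_ _ rfl hker)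
      rw [List.length_append, List.length_append]
      omega
    intro r hr
    have := main _ r.toWord rfl (by rw [FreeGroup.mk_toWord]; exact hr)
    rwa [FreeGroup.mk_toWord] at this
  · exact Subgroup.normalClosure_le_normal fun r hr => hr.1

end Presentation

/-! ### Permutation modules and the `ℓ¹`-norm -/

section PermutationModule

variable {Ω : Type*} {Ω' : Type*} {M : Type*} [AddCommGroup M] [Module ℚ M]

open MonoidAlgebra (single)

lemma l1Norm_eq_sum (x : MonoidAlgebra ℚ Ω) {s : Finset Ω} (hs : x.coeff.support ⊆ s) :
    l1Norm x = ∑ ω ∈ s, |(x.coeff ω : ℝ)| :=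
  Finsupp.sum_of_support_subset _ hs _ (by simp)

lemma l1Norm_nonneg (x : MonoidAlgebra ℚ Ω) : 0 ≤ l1Norm x :=
  Finset.sum_nonneg fun _ _ => abs_nonneg _

@[simp] lemma l1Norm_zero : l1Norm (0 : MonoidAlgebra ℚ Ω) = 0 := by
  simp [l1Norm]

@[simp] lemma l1Norm_single (ω : Ω) (a : ℚ) : l1Norm (single ω a) = |(a : ℝ)| := by
  simp [l1Norm]

lemma l1Norm_add_le (x y : MonoidAlgebra ℚ Ω) : l1Norm (x + y) ≤ l1Norm x + l1Norm y := by
  classical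
  rw [l1Norm_eq_sum (x + y) (s := x.coeff.support ∪ y.coeff.support)
      (by rw [MonoidAlgebra.coeff_add]; exact Finsupp.support_add),
    l1Norm_eq_sum x Finset.subset_union_left, l1Norm_eq_sum y Finset.subset_union_right,
    ← Finset.sum_add_distrib]
  refine Finset.sum_le_sum fun ω _ => ?_
  rw [MonoidAlgebra.coeff_add, Finsupp.add_apply, Rat.cast_add]
  exact abs_add_le _ _

lemma l1Norm_smul (a : ℚ) (x : MonoidAlgebra ℚ Ω) : l1Norm (a • x) = |(a : ℝ)| * l1Norm x := by
  rw [l1Norm_eq_sum (a • x) (s := x.coeff.support)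
    (by rw [MonoidAlgebra.coeff_smul]; exact Finsupp.support_smul),
    l1Norm_eq_sum x subset_rfl, Finset.mul_sum]
  refine Finset.sum_congr rfl fun ω _ => ?_
  rw [MonoidAlgebra.coeff_smul_apply, smul_eq_mul, Rat.cast_mul, abs_mul]

lemma l1Norm_neg (x : MonoidAlgebra ℚ Ω) : l1Norm (-x) = l1Norm x := by
  have := l1Norm_smul (-1) x
  simpa using this

/-- The linear map on a permutation module determined by its values on the basis. -/
noncomputable def linExt (F : Ω → M) : MonoidAlgebra ℚ Ω →ₗ[ℚ] M :=
  Finsupp.linearCombination ℚ F ∘ₗ (MonoidAlgebra.coeffLinearEquiv ℚ).toLinearMap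

lemma linExt_apply (F : Ω → M) (x : MonoidAlgebra ℚ Ω) :
    linExt F x = ∑ ω ∈ x.coeff.support, x.coeff ω • F ω := rfl

@[simp] lemma linExt_single (F : Ω → M) (ω : Ω) (a : ℚ) : linExt F (single ω a) = a • F ω := by
  simp [linExt]

lemma linearMap_ext {T T' : MonoidAlgebra ℚ Ω →ₗ[ℚ] M}
    (h : ∀ ω, T (single ω 1) = T' (single ω 1)) : T = T' := by
  ext ω
  simpa using h ω

lemma linExt_eq (T : MonoidAlgebra ℚ Ω →ₗ[ℚ] M) : linExt (fun ω => T (single ω 1)) = T := by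
  ext ω
  simp

lemma map_eq_sum (T : MonoidAlgebra ℚ Ω →ₗ[ℚ] M) (x : MonoidAlgebra ℚ Ω) :
    T x = ∑ ω ∈ x.coeff.support, x.coeff ω • T (single ω 1) := by
  conv_lhs => rw [← linExt_eq T]
  rfl

/-- A linear map bounded on the basis is bounded. -/
lemma norm_map_le (T : MonoidAlgebra ℚ Ω →ₗ[ℚ] M) (N : M → ℝ) (h0 : N 0 = 0)
    (hadd : ∀ a b, N (a + b) ≤ N a + N b) (hsmul : ∀ (q : ℚ) a, N (q • a) ≤ |(q : ℝ)| * N a)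
    (C : ℝ) (x : MonoidAlgebra ℚ Ω) (hC : ∀ ω ∈ x.coeff.support, N (T (single ω 1)) ≤ C) :
    N (T x) ≤ C * l1Norm x := by
  rw [map_eq_sum T x, l1Norm_eq_sum x subset_rfl, Finset.mul_sum]
  refine (Finset.le_sum_of_subadditive N h0.le hadd _ _).trans (Finset.sum_le_sum fun ω hω => ?_)
  refine (hsmul _ _).trans ?_
  rw [mul_comm C]
  exact mul_le_mul_of_nonneg_left (hC ω hω) (abs_nonneg _)

lemma l1Norm_map_le (T : MonoidAlgebra ℚ Ω →ₗ[ℚ] MonoidAlgebra ℚ Ω') (C : ℝ)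
    (hC : ∀ ω, l1Norm (T (single ω 1)) ≤ C) (x : MonoidAlgebra ℚ Ω) :
    l1Norm (T x) ≤ C * l1Norm x :=
  norm_map_le T l1Norm l1Norm_zero l1Norm_add_le (fun q a => (l1Norm_smul q a).le) C x
    fun ω _ => hC ω

lemma abs_map_le (T : MonoidAlgebra ℚ Ω →ₗ[ℚ] ℝ) (C : ℝ) (x : MonoidAlgebra ℚ Ω)
    (hC : ∀ ω ∈ x.coeff.support, |T (single ω 1)| ≤ C) : |T x| ≤ C * l1Norm x :=
  norm_map_le T (fun a => |a|) abs_zero abs_add_le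
    (fun q a => by rw [Rat.smul_def, abs_mul]) C x hC

section Group

variable {G : Type*} [Group G] [MulAction G Ω] {ρ : Representation ℚ G M}

/-- The morphism on a permutation module determined by an equivariant map on the basis. -/
noncomputable def equivariantExt (F : Ω → M) (hF : ∀ (g : G) ω, F (g • ω) = ρ g (F ω)) :
    (Representation.ofMulAction ℚ G Ω).IntertwiningMap ρ :=
  ⟨linExt F, fun g => by ext ω; simp [hF]⟩

lemma l1Norm_ofMulAction (g : G) (x : MonoidAlgebra ℚ Ω) :
    l1Norm (Representation.ofMulAction ℚ G Ω g x) = l1Norm x := by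
  have key : ∀ (g : G) (x : MonoidAlgebra ℚ Ω),
      l1Norm (Representation.ofMulAction ℚ G Ω g x) ≤ l1Norm x := fun g x => by
    have := l1Norm_map_le (Representation.ofMulAction ℚ G Ω g) 1 (by simp) x
    rwa [one_mul] at this
  refine le_antisymm (key g x) ?_
  have := key g⁻¹ (Representation.ofMulAction ℚ G Ω g x)
  rwa [Representation.inv_self_apply] at this

end Group

end PermutationModule

/-! ### Proper permutation modules of finite type -/

section FiniteType

variable {G : Type u} [Group G] {Ω : Type v} [MulAction G Ω]

lemma finite_quotient_of_finite {F : Set Ω} (hF : F.Finite) (h : ∀ ω : Ω, ∃ g : G, g • ω ∈ F) :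
    Finite (MulAction.orbitRel.Quotient G Ω) := by
  have := hF.to_subtype
  refine Finite.of_surjective
    (fun f : F => (Quotient.mk _ (f : Ω) : MulAction.orbitRel.Quotient G Ω)) fun q => ?_
  induction q using Quotient.inductionOn with
  | _ ω =>
  obtain ⟨g, hg⟩ := h ω
  exact ⟨⟨g • ω, hg⟩, Quotient.sound ⟨g, rfl⟩⟩

end FiniteType

open MonoidAlgebra (single)

/-! ### Fillings -/

section Fill

variable {Ω M : Type*} [AddCommGroup M] [Module ℚ M] {d : MonoidAlgebra ℚ Ω →ₗ[ℚ] M}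

/-- `a` is the boundary of a chain of norm at most `C`. -/
def HasFilling (d : MonoidAlgebra ℚ Ω →ₗ[ℚ] M) (a : M) (C : ℝ) : Prop :=
  ∃ x, d x = a ∧ l1Norm x ≤ C

lemma HasFilling.mono {a : M} {C C' : ℝ} (h : HasFilling d a C) (hC : C ≤ C') :
    HasFilling d a C' := by
  obtain ⟨x, hx, hl⟩ := h
  exact ⟨x, hx, hl.trans hC⟩

lemma HasFilling.zero : HasFilling d 0 0 := ⟨0, by simp, by simp⟩

lemma HasFilling.add {a b : M} {C C' : ℝ} (h : HasFilling d a C) (h' : HasFilling d b C') :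
    HasFilling d (a + b) (C + C') := by
  obtain ⟨x, hx, hl⟩ := h
  obtain ⟨y, hy, hl'⟩ := h'
  exact ⟨x + y, by rw [map_add, hx, hy], (l1Norm_add_le x y).trans (add_le_add hl hl')⟩

lemma HasFilling.smul {a : M} {C : ℝ} (h : HasFilling d a C) (q : ℚ) :
    HasFilling d (q • a) (|(q : ℝ)| * C) := by
  obtain ⟨x, hx, hl⟩ := h
  exact ⟨q • x, by rw [map_smul, hx],
    (l1Norm_smul q x).trans_le (mul_le_mul_of_nonneg_left hl (abs_nonneg _))⟩

lemma HasFilling.neg {a : M} {C : ℝ} (h : HasFilling d a C) : HasFilling d (-a) C := by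
  obtain ⟨x, hx, hl⟩ := h
  exact ⟨-x, by rw [map_neg, hx], (l1Norm_neg x).trans_le hl⟩

lemma HasFilling.sub {a b : M} {C C' : ℝ} (h : HasFilling d a C) (h' : HasFilling d b C') :
    HasFilling d (a - b) (C + C') := by
  rw [sub_eq_add_neg]
  exact h.add h'.neg

end Fill

/-! ### The Rips complex -/

section Rips

variable {V : Type v} (Γ : SimpleGraph V) (R : ℕ)

/-- Pairs of vertices at distance at most `R`. -/
def ripsPairs : Set (V × V) := {p | Γ.dist p.1 p.2 ≤ R}

/-- Triples of vertices at pairwise distance at most `R`. -/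
def ripsTriples : Set (V × V × V) :=
  {t | Γ.dist t.1 t.2.1 ≤ R ∧ Γ.dist t.2.1 t.2.2 ≤ R ∧ Γ.dist t.1 t.2.2 ≤ R}

/-- The boundary of a basis element of the chains of degree one. -/
noncomputable def ripsBd₁ (p : ripsPairs Γ R) : MonoidAlgebra ℚ V :=
  single p.1.2 1 - single p.1.1 1

open Classical in
/-- The basis element of the chains of degree one given by a pair of vertices at distance at most
`R`, and zero for other pairs. -/
noncomputable def ripsEdge (a b : V) : MonoidAlgebra ℚ (ripsPairs Γ R) :=
  if h : Γ.dist a b ≤ R then single ⟨(a, b), h⟩ 1 else 0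

/-- The boundary of a basis element of the chains of degree two. -/
noncomputable def ripsBd₂ (t : ripsTriples Γ R) : MonoidAlgebra ℚ (ripsPairs Γ R) :=
  ripsEdge Γ R t.1.1 t.1.2.1 + ripsEdge Γ R t.1.2.1 t.1.2.2 - ripsEdge Γ R t.1.1 t.1.2.2

variable {Γ R}

lemma ripsEdge_of_le {a b : V} (h : Γ.dist a b ≤ R) :
    ripsEdge Γ R a b = single ⟨(a, b), h⟩ 1 := dif_pos h

lemma l1Norm_ripsEdge_le (a b : V) : l1Norm (ripsEdge Γ R a b) ≤ 1 := by
  rw [ripsEdge]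
  split_ifs <;> simp

lemma linExt_ripsBd₁_ripsEdge {a b : V} (h : Γ.dist a b ≤ R) :
    linExt (ripsBd₁ Γ R) (ripsEdge Γ R a b) = single b 1 - single a 1 := by
  rw [ripsEdge_of_le h, linExt_single, one_smul, ripsBd₁]

lemma linExt_ripsBd₁_ripsBd₂ (t : ripsTriples Γ R) :
    linExt (ripsBd₁ Γ R) (ripsBd₂ Γ R t) = 0 := by
  rw [ripsBd₂, map_sub, map_add, linExt_ripsBd₁_ripsEdge t.2.1, linExt_ripsBd₁_ripsEdge t.2.2.1,
    linExt_ripsBd₁_ripsEdge t.2.2.2]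
  abel

lemma l1Norm_ripsBd₂_le (t : ripsTriples Γ R) : l1Norm (ripsBd₂ Γ R t) ≤ 3 := by
  rw [ripsBd₂, sub_eq_add_neg]
  have h1 := l1Norm_ripsEdge_le (Γ := Γ) (R := R) t.1.1 t.1.2.1
  have h2 := l1Norm_ripsEdge_le (Γ := Γ) (R := R) t.1.2.1 t.1.2.2
  have h3 := l1Norm_ripsEdge_le (Γ := Γ) (R := R) t.1.1 t.1.2.2
  rw [← l1Norm_neg] at h3
  refine (l1Norm_add_le _ _).trans ?_
  have h4 := l1Norm_add_le (ripsEdge Γ R t.1.1 t.1.2.1) (ripsEdge Γ R t.1.2.1 t.1.2.2)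
  linarith

lemma hasFilling_triangle {a b c : V} (h1 : Γ.dist a b ≤ R) (h2 : Γ.dist b c ≤ R)
    (h3 : Γ.dist a c ≤ R) : HasFilling (linExt (ripsBd₂ Γ R))
      (ripsEdge Γ R a b + ripsEdge Γ R b c - ripsEdge Γ R a c) 1 :=
  ⟨single ⟨(a, b, c), h1, h2, h3⟩ 1, by rw [linExt_single, one_smul, ripsBd₂], by simp⟩

/-- Pairs are neither oriented nor reduced, so degenerate pairs are basis elements; the constant
triple has the degenerate pair as its boundary. -/
lemma hasFilling_loop (a : V) : HasFilling (linExt (ripsBd₂ Γ R)) (ripsEdge Γ R a a) 1 := by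
  have := hasFilling_triangle (Γ := Γ) (R := R) (a := a) (b := a) (c := a) (by simp) (by simp)
    (by simp)
  rwa [add_sub_cancel_right] at this

variable (R) in
/-- The chain of degree one defined by a walk. -/
noncomputable def walkChain : {u v : V} → Γ.Walk u v → MonoidAlgebra ℚ (ripsPairs Γ R)
  | _, _, .nil => 0
  | u, _, .cons (v := v) _ p => ripsEdge Γ R u v + walkChain p

lemma walkChain_append {u v w : V} (p : Γ.Walk u v) (q : Γ.Walk v w) :
    walkChain R (p.append q) = walkChain R p + walkChain R q := by
  induction p with
  | nil => simp [walkChain]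
  | cons h p ih => simp [walkChain, ih, add_assoc]

lemma linExt_ripsBd₁_walkChain (hR : 1 ≤ R) {u v : V} (p : Γ.Walk u v) :
    linExt (ripsBd₁ Γ R) (walkChain R p) = single v 1 - single u 1 := by
  induction p with
  | nil => simp [walkChain]
  | cons h p ih =>
    rw [walkChain, map_add, ih, linExt_ripsBd₁_ripsEdge
      ((SimpleGraph.dist_eq_one_iff_adj.2 h).le.trans hR)]
    abel

/-- The cone over a short walk. -/
lemma hasFilling_walkChain_sub_ripsEdge {u v : V} (p : Γ.Walk u v) (hp : p.length ≤ R) :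
    HasFilling (linExt (ripsBd₂ Γ R)) (walkChain R p - ripsEdge Γ R u v) (p.length + 1) := by
  induction p with
  | nil => simpa [walkChain] using (hasFilling_loop _).neg
  | @cons u w v h p ih =>
    rw [SimpleGraph.Walk.length_cons] at hp
    have h1 := SimpleGraph.dist_le p
    have h2 := SimpleGraph.dist_le (SimpleGraph.Walk.cons h p)
    rw [SimpleGraph.Walk.length_cons] at h2
    have h3 := SimpleGraph.dist_eq_one_iff_adj.2 h
    have := (ih (by omega)).add (hasFilling_triangle (Γ := Γ) (R := R) (a := u) (b := w) (c := v)
      (by omega) (by omega) (by omega))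
    rw [SimpleGraph.Walk.length_cons]
    push_cast
    convert this using 1
    rw [walkChain]
    abel

/-- Closed walks in a hyperbolic graph satisfy a linear isoperimetric inequality. -/
lemma IsSlim.hasFilling_closedWalk (hΓ : Γ.Connected) {δ : ℕ} (hδ : IsSlim Γ δ)
    (hR : 4 * δ + 4 ≤ R) {v : V} (w : Γ.Walk v v) :
    HasFilling (linExt (ripsBd₂ Γ R)) (walkChain R w) ((2 * R + 2) * w.length) := by
  obtain ⟨n, hn⟩ : ∃ n, w.length = n := ⟨_, rfl⟩
  induction n using Nat.strong_induction_on generalizing w with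
  | _ n ih =>
  rcases Nat.lt_or_ge n (4 * δ + 4) with h | h
  · rcases Nat.eq_zero_or_pos n with h0 | h0
    · subst h0
      obtain rfl : w = .nil :=
        SimpleGraph.Walk.eq_nil_iff_nil.2 (SimpleGraph.Walk.length_eq_zero_iff.1 hn)
      simpa [walkChain] using HasFilling.zero
    · have := (hasFilling_walkChain_sub_ripsEdge (R := R) w (by omega)).add (hasFilling_loop v)
      rw [sub_add_cancel] at this
      refine this.mono ?_
      rw [hn]
      have h1 : (1 : ℝ) ≤ n := by exact_mod_cast h0
      have h2 : (4 : ℝ) ≤ R := by exact_mod_cast (by omega : 4 ≤ R)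
      nlinarith
  · obtain ⟨a, b, p₁, p₂, p₃, rfl, hl, hd⟩ := hδ.exists_subwalk hΓ w (hn ▸ h)
    obtain ⟨q, hq⟩ := hΓ.exists_walk_length_eq_dist a b
    simp only [SimpleGraph.Walk.length_append] at hn
    have h1 := ih _ (by simp only [SimpleGraph.Walk.length_append]; omega)
      (p₁.append (q.append p₃)) rfl
    have h2 := hasFilling_walkChain_sub_ripsEdge (R := R) p₂ (by omega)
    have h3 := hasFilling_walkChain_sub_ripsEdge (R := R) q (by omega)
    -- Exchanging p₂ for the geodesic q costs at most 2R+2 and shortens the walk by at least one,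
    -- whence the slope 2R+2.
    have := h1.add (h2.sub h3)
    simp only [walkChain_append] at this ⊢
    convert this.mono ?_ using 1
    · abel
    · simp only [SimpleGraph.Walk.length_append, Nat.cast_add]
      have e1 : (q.length : ℝ) + 1 ≤ p₂.length := by exact_mod_cast (by omega : q.length + 1 ≤ p₂.length)
      have e2 : (p₂.length : ℝ) ≤ R := by exact_mod_cast (by omega : p₂.length ≤ R)
      have e3 : (0 : ℝ) ≤ R := Nat.cast_nonneg R
      nlinarith [mul_le_mul_of_nonneg_left e1 (by positivity : (0 : ℝ) ≤ 2 * R + 2)]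

end Rips

/-! ### Decomposition of cycles into closed walks -/

section Cycles

variable {V : Type v} {Γ : SimpleGraph V} {R : ℕ}

/-- A chain with integral coefficients. -/
def IsIntegralChain {Ω : Type*} (m : MonoidAlgebra ℚ Ω) : Prop :=
  ∀ ω, ∃ z : ℤ, m.coeff ω = z

lemma IsIntegralChain.add_single {Ω : Type*} {m : MonoidAlgebra ℚ Ω} (hm : IsIntegralChain m)
    (ω : Ω) (z : ℤ) : IsIntegralChain (m + single ω (z : ℚ)) := by
  classical
  intro ω'
  obtain ⟨y, hy⟩ := hm ω'
  rw [MonoidAlgebra.coeff_add, Finsupp.add_apply, MonoidAlgebra.coeff_single, Finsupp.single_apply, hy]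
  split_ifs
  · exact ⟨y + z, by push_cast; ring⟩
  · exact ⟨y, by simp⟩

/-- Moving a nonzero integral coefficient one unit towards zero thus lowers the norm by exactly one,
which drives the induction on cycles. -/
lemma l1Norm_add_single {Ω : Type*} (m : MonoidAlgebra ℚ Ω) (ω : Ω) (a : ℚ) :
    l1Norm (m + single ω a) = l1Norm m - |(m.coeff ω : ℝ)| + |((m.coeff ω + a : ℚ) : ℝ)| := by
  classical
  have h1 : (m + single ω a).coeff.support ⊆ insert ω m.coeff.support := by
    intro ω' h
    rw [Finset.mem_insert, or_iff_not_imp_left]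
    intro hne
    rw [Finsupp.mem_support_iff, MonoidAlgebra.coeff_add, Finsupp.add_apply,
      MonoidAlgebra.coeff_single, Finsupp.single_apply, if_neg (Ne.symm hne), add_zero] at h
    exact Finsupp.mem_support_iff.2 h
  rw [l1Norm_eq_sum _ h1, l1Norm_eq_sum m (Finset.subset_insert ω _),
    ← Finset.add_sum_erase _ _ (Finset.mem_insert_self ω _),
    ← Finset.add_sum_erase _ _ (Finset.mem_insert_self ω _)]
  have h2 : ∀ ω' ∈ (insert ω m.coeff.support).erase ω,
      |((m + single ω a).coeff ω' : ℝ)| = |(m.coeff ω' : ℝ)| := fun ω' h => by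
    rw [MonoidAlgebra.coeff_add, Finsupp.add_apply, MonoidAlgebra.coeff_single, Finsupp.single_apply,
      if_neg (Finset.ne_of_mem_erase h).symm, add_zero]
  rw [Finset.sum_congr rfl h2, MonoidAlgebra.coeff_add, Finsupp.add_apply,
    MonoidAlgebra.coeff_single, Finsupp.single_apply, if_pos rfl]
  ring

/-- An oriented edge in the support of an integral chain can be exchanged for a walk. -/
lemma exists_exchange (hΓ : Γ.Connected) {m : MonoidAlgebra ℚ (ripsPairs Γ R)}
    (hm : IsIntegralChain m) (ω : ripsPairs Γ R) (s t : V)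
    (h : (0 < m.coeff ω ∧ s = ω.1.1 ∧ t = ω.1.2) ∨ (m.coeff ω < 0 ∧ s = ω.1.2 ∧ t = ω.1.1)) :
    ∃ (m' : MonoidAlgebra ℚ (ripsPairs Γ R)) (p : Γ.Walk s t), IsIntegralChain m' ∧
      l1Norm m' = l1Norm m - 1 ∧ p.length ≤ R ∧
      linExt (ripsBd₁ Γ R) m' = linExt (ripsBd₁ Γ R) m - (single t 1 - single s 1) ∧
      HasFilling (linExt (ripsBd₂ Γ R)) (m - m' - walkChain R p) (R + 3) := by
  obtain ⟨⟨a, b⟩, hab⟩ := ω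
  have hab' : Γ.dist a b ≤ R := hab
  obtain ⟨z, hz⟩ := hm ⟨(a, b), hab⟩
  rcases h with ⟨hpos, rfl, rfl⟩ | ⟨hneg, rfl, rfl⟩
  · obtain ⟨p, hp⟩ := hΓ.exists_walk_length_eq_dist s t
    have hz1 : 1 ≤ z := by
      rw [hz] at hpos
      exact_mod_cast hpos
    have hz1' : (1 : ℝ) ≤ z := by exact_mod_cast hz1
    refine ⟨m + single ⟨(s, t), hab⟩ ((-1 : ℤ) : ℚ), p, hm.add_single _ _, ?_, by omega, ?_, ?_⟩
    · rw [l1Norm_add_single, hz]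
      push_cast
      rw [abs_of_nonneg (by linarith), abs_of_nonneg (by linarith)]
      ring
    · rw [map_add, linExt_single, ripsBd₁]
      rw [Int.cast_neg, Int.cast_one, neg_one_smul, ← sub_eq_add_neg]
    · have := (hasFilling_walkChain_sub_ripsEdge (R := R) p (by omega)).neg
      refine HasFilling.mono (C := p.length + 1) ?_ ?_
      · convert this using 1
        rw [ripsEdge_of_le hab']
        simp [MonoidAlgebra.single_neg]
      · have : (p.length : ℝ) ≤ R := by exact_mod_cast (by omega : p.length ≤ R)
        linarith
  · obtain ⟨p, hp⟩ := hΓ.exists_walk_length_eq_dist s t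
    have hba : Γ.dist s t ≤ R := by rwa [SimpleGraph.dist_comm]
    have hz1 : z ≤ -1 := by
      rw [hz] at hneg
      have : z < 0 := by exact_mod_cast hneg
      omega
    have hz1' : (z : ℝ) ≤ -1 := by exact_mod_cast hz1
    refine ⟨m + single ⟨(t, s), hab⟩ ((1 : ℤ) : ℚ), p, hm.add_single _ _, ?_, by omega, ?_, ?_⟩
    · rw [l1Norm_add_single, hz]
      push_cast
      rw [abs_of_nonpos (by linarith), abs_of_nonpos (by linarith)]
      ring
    · rw [map_add, linExt_single, ripsBd₁]
      rw [Int.cast_one, one_smul, ← neg_sub (single t 1), ← sub_eq_add_neg]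
    · have h1 := hasFilling_walkChain_sub_ripsEdge (R := R) p (by omega)
      -- The pairs (t,s) and (s,t) are unrelated basis elements; the degenerate triple (t,s,t), up
      -- to a loop, identifies one with minus the other.
      have h2 := hasFilling_triangle (Γ := Γ) (R := R) (a := t) (b := s) (c := t) hab' hba (by simp)
      have := ((h1.add h2).add (hasFilling_loop t)).neg
      refine HasFilling.mono (C := p.length + 1 + 1 + 1) ?_ ?_
      · convert this using 1
        rw [ripsEdge_of_le hab']
        simp
        abel
      · have : (p.length : ℝ) ≤ R := by exact_mod_cast (by omega : p.length ≤ R)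
        linarith

/-- If the boundary of a chain is negative at a vertex, some oriented edge starts there. -/
lemma exists_edge_of_boundary_neg (m : MonoidAlgebra ℚ (ripsPairs Γ R)) (b : V)
    (h : (linExt (ripsBd₁ Γ R) m).coeff b < 0) :
    ∃ (ω : ripsPairs Γ R) (t : V),
      (0 < m.coeff ω ∧ b = ω.1.1 ∧ t = ω.1.2) ∨ (m.coeff ω < 0 ∧ b = ω.1.2 ∧ t = ω.1.1) := by
  classical
  by_contra! hcon
  refine not_le.2 h ?_
  rw [linExt_apply, MonoidAlgebra.coeff_sum, Finsupp.finsetSum_apply]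
  refine Finset.sum_nonneg fun ω _ => ?_
  rw [MonoidAlgebra.coeff_smul_apply, ripsBd₁, MonoidAlgebra.coeff_sub, Finsupp.sub_apply,
    MonoidAlgebra.coeff_single, Finsupp.single_apply, MonoidAlgebra.coeff_single, Finsupp.single_apply, smul_eq_mul]
  have h1 := (hcon ω ω.1.2).1
  have h2 := (hcon ω ω.1.1).2
  by_cases e1 : ω.1.2 = b <;> by_cases e2 : ω.1.1 = b
  · simp [e1, e2]
  · rw [if_pos e1, if_neg e2]
    have : ¬ m.coeff ω < 0 := fun hlt => h2 hlt e1.symm rfl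
    linarith
  · rw [if_neg e1, if_pos e2]
    have : ¬ 0 < m.coeff ω := fun hlt => h1 hlt e2.symm rfl
    linarith
  · simp [e1, e2]

/-- Linear isoperimetric inequality for an integral chain completed to a cycle by a walk. -/
lemma IsSlim.hasFilling_integral_add (hΓ : Γ.Connected) {δ : ℕ} (hδ : IsSlim Γ δ)
    (hR : 4 * δ + 4 ≤ R) (n : ℕ) (m : MonoidAlgebra ℚ (ripsPairs Γ R)) (hm : IsIntegralChain m)
    (hn : l1Norm m < n + 1) {a b : V} (p : Γ.Walk a b)
    (hp : linExt (ripsBd₁ Γ R) m = single a 1 - single b 1) :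
    HasFilling (linExt (ripsBd₂ Γ R)) (m + walkChain R p)
      ((2 * R + 2) * (R * n + p.length) + (R + 3) * n) := by
  classical
  induction n generalizing m a b with
  | zero =>
    have h0 : m = 0 := by
      ext ω
      obtain ⟨z, hz⟩ := hm ω
      have h1 : |(m.coeff ω : ℝ)| ≤ l1Norm m := by
        by_cases hω : ω ∈ m.coeff.support
        · exact Finset.single_le_sum (f := fun ω => |(m.coeff ω : ℝ)|)
            (fun _ _ => abs_nonneg _) hω
        · rw [Finsupp.notMem_support_iff.1 hω]
          simpa using l1Norm_nonneg m
      have h2 : |(m.coeff ω : ℝ)| < 1 := by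
        refine h1.trans_lt ?_
        simpa using hn
      rw [hz] at h2 ⊢
      have h3 : |z| < 1 := by exact_mod_cast h2
      rw [Int.abs_lt_one_iff.1 h3]
      rfl
    subst h0
    have hab : a = b := by
      rw [map_zero, eq_comm, sub_eq_zero] at hp
      exact (MonoidAlgebra.single_left_inj one_ne_zero).1 hp
    subst hab
    have := hδ.hasFilling_closedWalk hΓ hR p
    simpa using this
  | succ n ih =>
    by_cases hm0 : m = 0
    · subst hm0
      have hab : a = b := by
        rw [map_zero, eq_comm, sub_eq_zero] at hp
        exact (MonoidAlgebra.single_left_inj one_ne_zero).1 hp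
      subst hab
      have := hδ.hasFilling_closedWalk hΓ hR p
      rw [zero_add]
      refine this.mono ?_
      have h1 : (0 : ℝ) ≤ (2 * R + 2) * (R * (n + 1 : ℕ)) + (R + 3) * (n + 1 : ℕ) := by positivity
      linarith
    -- Once the walk has closed up it is filled separately, and a new walk starts from any edge left
    -- in the chain.
    by_cases hab : a = b
    · subst hab
      obtain ⟨ω, hω⟩ : ∃ ω, m.coeff ω ≠ 0 := by
        by_contra! h
        exact hm0 (MonoidAlgebra.ext (Finsupp.ext h))
      obtain ⟨s, t, hst⟩ : ∃ s t, (0 < m.coeff ω ∧ s = ω.1.1 ∧ t = ω.1.2) ∨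
          (m.coeff ω < 0 ∧ s = ω.1.2 ∧ t = ω.1.1) := by
        rcases hω.lt_or_gt with h | h
        · exact ⟨_, _, .inr ⟨h, rfl, rfl⟩⟩
        · exact ⟨_, _, .inl ⟨h, rfl, rfl⟩⟩
      obtain ⟨m', q, hm', hl, hq, hd, hF⟩ := exists_exchange hΓ hm ω s t hst
      have h1 := ih m' hm' (by push_cast at hn; linarith) q (by rw [hd, hp]; abel)
      have := (h1.add hF).add (hδ.hasFilling_closedWalk hΓ hR p)
      convert this.mono ?_ using 1
      · abel
      · have e1 : (q.length : ℝ) ≤ R := by exact_mod_cast hq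
        push_cast
        nlinarith [mul_le_mul_of_nonneg_left e1 (by positivity : (0 : ℝ) ≤ 2 * R + 2)]
    -- The walk is still open: the boundary of m is negative at its endpoint b, so some remaining
    -- edge leaves b and prolongs the walk.
    · have hneg : (linExt (ripsBd₁ Γ R) m).coeff b < 0 := by
        rw [hp, MonoidAlgebra.coeff_sub, Finsupp.sub_apply, MonoidAlgebra.coeff_single, Finsupp.single_apply,
          MonoidAlgebra.coeff_single, Finsupp.single_apply, if_neg hab, if_pos rfl]
        norm_num
      obtain ⟨ω, t, hst⟩ := exists_edge_of_boundary_neg m b hneg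
      obtain ⟨m', q, hm', hl, hq, hd, hF⟩ := exists_exchange hΓ hm ω b t hst
      have h1 := ih m' hm' (by push_cast at hn; linarith) (p.append q) (by rw [hd, hp]; abel)
      have := h1.add hF
      rw [walkChain_append] at this
      convert this.mono ?_ using 1
      · abel
      · have e1 : (q.length : ℝ) ≤ R := by exact_mod_cast hq
        rw [SimpleGraph.Walk.length_append]
        push_cast
        nlinarith [mul_le_mul_of_nonneg_left e1 (by positivity : (0 : ℝ) ≤ 2 * R + 2)]

/-- The filling inequality is homogeneous, so clearing denominators reduces rational cycles to
integral ones. -/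
lemma exists_integral_multiple {Ω : Type*} (m : MonoidAlgebra ℚ Ω) :
    ∃ k : ℕ, 0 < k ∧ IsIntegralChain ((k : ℚ) • m) := by
  classical
  refine ⟨∏ ω ∈ m.coeff.support, (m.coeff ω).den, Finset.prod_pos fun ω _ => (m.coeff ω).den_pos,
    fun ω => ?_⟩
  rw [MonoidAlgebra.coeff_smul_apply, smul_eq_mul]
  by_cases hω : ω ∈ m.coeff.support
  · rw [← Finset.prod_erase_mul _ _ hω]
    refine ⟨(∏ ω ∈ m.coeff.support.erase ω, (m.coeff ω).den : ℕ) * (m.coeff ω).num, ?_⟩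
    push_cast
    rw [mul_assoc, mul_comm ((m.coeff ω).den : ℚ), Rat.mul_den_eq_num]
  · exact ⟨0, by rw [Finsupp.notMem_support_iff.1 hω]; simp⟩

/-- The homological linear isoperimetric inequality for hyperbolic graphs. -/
lemma IsSlim.hasFilling_cycle (hΓ : Γ.Connected) {δ : ℕ} (hδ : IsSlim Γ δ)
    (hR : 4 * δ + 4 ≤ R) (m : MonoidAlgebra ℚ (ripsPairs Γ R))
    (hm : linExt (ripsBd₁ Γ R) m = 0) :
    HasFilling (linExt (ripsBd₂ Γ R)) m (((2 * R + 2) * R + (R + 3)) * l1Norm m) := by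
  obtain ⟨k, hk, hint⟩ := exists_integral_multiple m
  obtain ⟨a⟩ := hΓ.nonempty
  have hk' : (0 : ℝ) < k := by exact_mod_cast hk
  have h1 := hδ.hasFilling_integral_add hΓ hR ⌊l1Norm ((k : ℚ) • m)⌋₊ _ hint
    (Nat.lt_floor_add_one _) (SimpleGraph.Walk.nil (u := a)) (by rw [map_smul, hm]; simp)
  have h2 := h1.smul (k : ℚ)⁻¹
  have h3 : (k : ℚ)⁻¹ • ((k : ℚ) • m + walkChain R (SimpleGraph.Walk.nil (G := Γ) (u := a))) = m := by
    rw [walkChain, add_zero, smul_smul, inv_mul_cancel₀ (by exact_mod_cast hk.ne'), one_smul]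
  rw [h3] at h2
  refine h2.mono ?_
  have h4 := Nat.floor_le (l1Norm_nonneg ((k : ℚ) • m))
  rw [l1Norm_smul] at h4
  push_cast at h4 ⊢
  rw [abs_of_pos hk'] at h4
  rw [abs_of_pos (inv_pos.2 hk'), inv_mul_le_iff₀ hk', l1Norm_smul]
  push_cast
  rw [abs_of_pos hk']
  simp only [SimpleGraph.Walk.length_nil, Nat.cast_zero, add_zero]
  have h5 := mul_le_mul_of_nonneg_left h4 (by positivity : (0 : ℝ) ≤ (2 * R + 2) * R + (R + 3))
  linarith

end Cycles

/-! ### Hyperbolic groups satisfy the weak linear isoperimetric inequality -/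

section HyperbolicWeak

variable {G : Type u} [Group G] [TopologicalSpace G] {V : Type u} [MulAction G V] {Γ : SimpleGraph V}

/-- Equivariance of π puts the stabilizer of ω, which is open and hence closed, inside the compact
stabilizer of π ω. By transitivity on vertices, one finite fibre meets all orbits. -/
lemma IsCayleyAbelsGraph.isFiniteTypeProper [IsTopologicalGroup G] (hΓ : IsCayleyAbelsGraph G Γ)
    {Ω : Type v}
    [MulAction G Ω] (hne : Nonempty Ω) (π : Ω → V) (hπ : ∀ (g : G) ω, π (g • ω) = g • π ω)
    (hopen : ∀ ω : Ω, IsOpen (MulAction.stabilizer G ω : Set G))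
    (hfin : ∀ x, {ω | π ω = x}.Finite) : IsFiniteTypeProper G Ω where
  nonempty := hne
  isOpen_stabilizer := hopen
  isCompact_stabilizer ω := by
    refine (hΓ.isCompact_stabilizer (π ω)).of_isClosed_subset
      (Subgroup.isClosed_of_isOpen _ (hopen ω)) fun g hg => ?_
    rw [SetLike.mem_coe, MulAction.mem_stabilizer_iff] at hg ⊢
    rw [← hπ, hg]
  finite_orbits := by
    obtain ⟨x⟩ := hΓ.connected.nonempty
    refine finite_quotient_of_finite (hfin x) fun ω => ?_
    obtain ⟨g, hg⟩ := hΓ.transitive (π ω) x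
    exact ⟨g, (hπ g ω).trans hg⟩

/-- The action on pairs of vertices at bounded distance. -/
@[reducible] def IsCayleyAbelsGraph.pairsAction (hΓ : IsCayleyAbelsGraph G Γ) (R : ℕ) :
    MulAction G (ripsPairs Γ R) where
  smul g p := ⟨(g • p.1.1, g • p.1.2), (hΓ.dist_smul g _ _).trans_le p.2⟩
  one_smul p := Subtype.ext (Prod.ext (one_smul G p.1.1) (one_smul G p.1.2))
  mul_smul g h p := Subtype.ext (Prod.ext (mul_smul g h p.1.1) (mul_smul g h p.1.2))

/-- The action on triples of vertices at bounded distance. -/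
@[reducible] def IsCayleyAbelsGraph.triplesAction (hΓ : IsCayleyAbelsGraph G Γ) (R : ℕ) :
    MulAction G (ripsTriples Γ R) where
  smul g t := ⟨(g • t.1.1, g • t.1.2.1, g • t.1.2.2), (hΓ.dist_smul g _ _).trans_le t.2.1,
    (hΓ.dist_smul g _ _).trans_le t.2.2.1, (hΓ.dist_smul g _ _).trans_le t.2.2.2⟩
  one_smul t := Subtype.ext (Prod.ext (one_smul G t.1.1)
    (Prod.ext (one_smul G t.1.2.1) (one_smul G t.1.2.2)))
  mul_smul g h t := Subtype.ext (Prod.ext (mul_smul g h t.1.1)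
    (Prod.ext (mul_smul g h t.1.2.1) (mul_smul g h t.1.2.2)))

lemma IsCayleyAbelsGraph.finite_pairs (hΓ : IsCayleyAbelsGraph G Γ) (R : ℕ) (x : V) :
    {p : ripsPairs Γ R | p.1.1 = x}.Finite := by
  refine Set.Finite.of_finite_image (f := fun p => p.1.2)
    ((hΓ.finite_ball x R).subset ?_) ?_
  · rintro _ ⟨⟨⟨a, b⟩, h⟩, rfl, rfl⟩
    exact h
  · rintro ⟨⟨a, b⟩, h⟩ rfl ⟨⟨a', b'⟩, h'⟩ ha hb
    exact Subtype.ext (Prod.ext ha.symm hb)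

lemma IsCayleyAbelsGraph.finite_triples (hΓ : IsCayleyAbelsGraph G Γ) (R : ℕ) (x : V) :
    {t : ripsTriples Γ R | t.1.1 = x}.Finite := by
  refine Set.Finite.of_finite_image (f := fun t => t.1.2)
    (((hΓ.finite_ball x R).prod (hΓ.finite_ball x R)).subset ?_) ?_
  · rintro _ ⟨⟨⟨a, b, c⟩, h⟩, rfl, rfl⟩
    exact ⟨h.1, h.2.2⟩
  · rintro ⟨⟨a, b, c⟩, h⟩ rfl ⟨⟨a', b', c'⟩, h'⟩ ha hb
    exact Subtype.ext (Prod.ext ha.symm hb)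

/-- The resolution is the start of the Rips complex. Linear fillings bound the filling norm of the
kernel by the ℓ¹-norm; the reverse bound holds because a triple has boundary of norm at most 3. -/
theorem IsCayleyAbelsGraph.weakLinearIsoperimetricInequality [IsTopologicalGroup G]
    (hΓ : IsCayleyAbelsGraph G Γ) {δ : ℕ} (hδ : IsSlim Γ δ) : WeakLinearIsoperimetricInequality G := by
  classical
  obtain ⟨x₀⟩ := hΓ.connected.nonempty
  obtain ⟨R, hR⟩ : ∃ R, R = 4 * δ + 4 := ⟨_, rfl⟩
  let A₁ := hΓ.pairsAction R
  let A₂ := hΓ.triplesAction R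
  have hsmul₁ : ∀ (g : G) (p : ripsPairs Γ R), (g • p).1 = (g • p.1.1, g • p.1.2) :=
    fun _ _ => rfl
  have hsmul₂ : ∀ (g : G) (t : ripsTriples Γ R),
    (g • t).1 = (g • t.1.1, g • t.1.2.1, g • t.1.2.2) := fun _ _ => rfl
  have hb₁ : ∀ (g : G) p, ripsBd₁ Γ R (g • p) =
      Representation.ofMulAction ℚ G V g (ripsBd₁ Γ R p) := fun g p => by
    rw [ripsBd₁, ripsBd₁, map_sub, Representation.ofMulAction_single,
      Representation.ofMulAction_single, hsmul₁]
  have hedge : ∀ (g : G) a b, ripsEdge Γ R (g • a) (g • b) =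
      Representation.ofMulAction ℚ G (ripsPairs Γ R) g (ripsEdge Γ R a b) := fun g a b => by
    by_cases h : Γ.dist a b ≤ R
    · rw [ripsEdge_of_le h, ripsEdge_of_le ((hΓ.dist_smul g a b).trans_le h),
        Representation.ofMulAction_single]
      rfl
    · rw [ripsEdge, ripsEdge, dif_neg h, dif_neg (by rwa [hΓ.dist_smul]), map_zero]
  have hb₂ : ∀ (g : G) t, ripsBd₂ Γ R (g • t) =
      Representation.ofMulAction ℚ G (ripsPairs Γ R) g (ripsBd₂ Γ R t) := fun g t => by
    rw [ripsBd₂, ripsBd₂, map_sub, map_add, ← hedge, ← hedge, ← hedge, hsmul₂]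
  let d₁ := equivariantExt (ripsBd₁ Γ R) hb₁
  let d₂ := equivariantExt (ripsBd₂ Γ R) hb₂
  let ε := equivariantExt (G := G) (ρ := Representation.trivial ℚ G ℚ) (fun _ : V => (1 : ℚ))
    (fun g ω => rfl)
  have hd₁d₂ : ∀ x, d₁ (d₂ x) = 0 := fun x => by
    have : linExt (ripsBd₁ Γ R) ∘ₗ linExt (ripsBd₂ Γ R) = 0 := by
      refine linearMap_ext fun t => ?_
      simp [linExt_ripsBd₁_ripsBd₂]
    exact congrArg (fun f => f x) this
  have hfill : ∀ m, d₁ m = 0 → HasFilling (linExt (ripsBd₂ Γ R)) m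
      (((2 * R + 2) * R + (R + 3)) * l1Norm m) := fun m hm =>
    hδ.hasFilling_cycle hΓ.connected hR.ge m hm
  have hp₁ : IsFiniteTypeProper G (ripsPairs Γ R) := by
    refine hΓ.isFiniteTypeProper ⟨⟨(x₀, x₀), by simp [ripsPairs]⟩⟩ (fun p => p.1.1)
      (fun _ _ => rfl) (fun p => ?_) (hΓ.finite_pairs R)
    convert (hΓ.isOpen_stabilizer p.1.1).inter (hΓ.isOpen_stabilizer p.1.2) using 1
    ext g
    simp only [SetLike.mem_coe, MulAction.mem_stabilizer_iff, Set.mem_inter_iff]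
    rw [Subtype.ext_iff, hsmul₁, Prod.ext_iff]
  have hp₂ : IsFiniteTypeProper G (ripsTriples Γ R) := by
    refine hΓ.isFiniteTypeProper ⟨⟨(x₀, x₀, x₀), by simp [ripsTriples]⟩⟩ (fun p => p.1.1)
      (fun _ _ => rfl) (fun p => ?_) (hΓ.finite_triples R)
    convert (hΓ.isOpen_stabilizer p.1.1).inter
      ((hΓ.isOpen_stabilizer p.1.2.1).inter (hΓ.isOpen_stabilizer p.1.2.2)) using 1
    ext g
    simp only [SetLike.mem_coe, MulAction.mem_stabilizer_iff, Set.mem_inter_iff]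
    rw [Subtype.ext_iff, hsmul₂, Prod.ext_iff, Prod.ext_iff]
  refine ⟨V, ripsPairs Γ R, ripsTriples Γ R, inferInstance, A₁, A₂, d₂, d₁, ε, ?_, ?_⟩
  · refine ⟨?_, hp₁, hp₂, fun q => ⟨single x₀ q, ?_⟩, fun y => ⟨fun hy => ?_, ?_⟩,
      fun m => ⟨?_, ?_⟩⟩
    · refine hΓ.isFiniteTypeProper ⟨x₀⟩ id (fun _ _ => rfl) hΓ.isOpen_stabilizer fun x => ?_
      simp
    · exact (linExt_single _ _ _).trans (by simp)
    -- Walks from x₀ define a contracting homotopy s with ∂₁ s = id − x₀ ε, so a chain with zero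
    -- augmentation is a boundary.
    · choose p _ using fun v => hΓ.connected.exists_walk_length_eq_dist x₀ v
      refine ⟨linExt (fun v => walkChain R (p v)) y, ?_⟩
      change linExt (ripsBd₁ Γ R) _ = y
      have hcomp : linExt (ripsBd₁ Γ R) ∘ₗ linExt (fun v => walkChain R (p v)) =
          LinearMap.id - (LinearMap.toSpanSingleton ℚ _ (single x₀ (1 : ℚ))) ∘ₗ
            linExt (fun _ : V => (1 : ℚ)) := by
        refine linearMap_ext fun v => ?_
        simp [linExt_ripsBd₁_walkChain (by omega : 1 ≤ R)]
      have h1 := congrArg (fun f => f y) hcomp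
      have h2 : linExt (fun _ : V => (1 : ℚ)) y = 0 := hy
      simpa [h2] using h1
    · rintro ⟨m, rfl⟩
      have : linExt (fun _ : V => (1 : ℚ)) ∘ₗ linExt (ripsBd₁ Γ R) = 0 := by
        refine linearMap_ext fun p => ?_
        simp [ripsBd₁]
      exact congrArg (fun f => f m) this
    · intro hm
      obtain ⟨x, hx, -⟩ := hfill m hm
      exact ⟨x, hx⟩
    · rintro ⟨x, rfl⟩
      exact hd₁d₂ x
  · have hker : ∀ t : ripsTriples Γ R, ripsBd₂ Γ R t ∈ d₁.ker.toSubmodule :=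
      fun t => linExt_ripsBd₁_ripsBd₂ t
    let dK := equivariantExt (G := G) (ρ := d₁.ker.toRepresentation)
      (fun t : ripsTriples Γ R => (⟨ripsBd₂ Γ R t, hker t⟩ : d₁.ker.toSubmodule))
      (fun g t => Subtype.ext (hb₂ g t))
    have hdK : ∀ x, ((dK x : d₁.ker.toSubmodule) : MonoidAlgebra ℚ (ripsPairs Γ R)) =
        linExt (ripsBd₂ Γ R) x := fun x => by
      have : d₁.ker.toSubmodule.subtype ∘ₗ
          linExt (fun t : ripsTriples Γ R => (⟨ripsBd₂ Γ R t, hker t⟩ : d₁.ker.toSubmodule)) =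
          linExt (ripsBd₂ Γ R) := by
        refine linearMap_ext fun t => ?_
        simp
      exact congrArg (fun f => f x) this
    have hsurj : Function.Surjective dK := fun m => by
      obtain ⟨x, hx, -⟩ := hfill m.1 m.2
      exact ⟨x, Subtype.ext ((hdK x).trans hx)⟩
    -- The identity of ℚ[pairs] makes the ℓ¹-norm itself a filling norm; on the kernel the filling
    -- norm is that of the corestricted boundary map.
    refine ⟨l1Norm, fun m => sInf {t : ℝ | ∃ x, dK x = m ∧ t = l1Norm x}, ?_,
      ⟨ripsTriples Γ R, A₂, hp₂, dK, hsurj, fun m => rfl⟩, ⟨3, by norm_num, fun m => ?_⟩,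
      ⟨(2 * R + 2) * R + (R + 3), by positivity, fun m => ?_⟩⟩
    · refine ⟨ripsPairs Γ R, A₁, hp₁, Representation.IntertwiningMap.id _, fun m => ⟨m, rfl⟩,
        fun m => ?_⟩
      have : {t : ℝ | ∃ x : MonoidAlgebra ℚ (ripsPairs Γ R), Representation.IntertwiningMap.id
          (Representation.ofMulAction ℚ G (ripsPairs Γ R)) x = m ∧ t = l1Norm x} = {l1Norm m} := by
        ext t
        constructor
        · rintro ⟨x, rfl, rfl⟩
          rfl
        · rintro rfl
          exact ⟨m, rfl, rfl⟩
      rw [this, csInf_singleton]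
    · rw [← div_le_iff₀' (by norm_num)]
      obtain ⟨x, hx⟩ := hsurj m
      refine le_csInf ⟨_, x, hx, rfl⟩ ?_
      rintro _ ⟨y, rfl, rfl⟩
      rw [div_le_iff₀' (by norm_num)]
      change l1Norm (dK y).1 ≤ _
      rw [hdK]
      exact l1Norm_map_le _ 3 (fun t => by simpa using l1Norm_ripsBd₂_le t) y
    · obtain ⟨x, hx, hl⟩ := hfill m.1 m.2
      refine csInf_le_of_le ⟨0, ?_⟩ ⟨x, Subtype.ext ((hdK x).trans hx), rfl⟩ hl
      rintro _ ⟨y, -, rfl⟩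
      exact l1Norm_nonneg y

end HyperbolicWeak

/-! ### Existence of Cayley-Abels graphs -/

section Existence

variable {G : Type u} [Group G] [TopologicalSpace G] [IsTopologicalGroup G]
  {V : Type v} [MulAction G V]

/-- Join g x₀ to g k x₀ for k in a compact generating set. Generation gives connectedness;
compactness of K together with compact open stabilizers gives local finiteness. -/
theorem IsCompactlyGenerated.exists_isCayleyAbelsGraph (hG : IsCompactlyGenerated G) (x₀ : V)
    (htrans : ∀ x : V, ∃ g : G, g • x₀ = x)
    (hopen : ∀ x : V, IsOpen (MulAction.stabilizer G x : Set G))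
    (hcomp : ∀ x : V, IsCompact (MulAction.stabilizer G x : Set G)) :
    ∃ Γ : SimpleGraph V, IsCayleyAbelsGraph G Γ := by
  obtain ⟨K, hK, hgen⟩ := hG
  let r : V → V → Prop := fun x y => ∃ g : G, ∃ k ∈ K, x = g • x₀ ∧ y = (g * k) • x₀
  have hr : ∀ (g : G) x y, r x y → r (g • x) (g • y) := by
    rintro g _ _ ⟨h, k, hk, rfl, rfl⟩
    exact ⟨g * h, k, hk, by rw [mul_smul], by simp only [mul_smul]⟩
  let Γ := SimpleGraph.fromRel r
  have hadj : ∀ (g : G) x y, Γ.Adj x y → Γ.Adj (g • x) (g • y) := by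
    intro g x y h
    rw [SimpleGraph.fromRel_adj] at h ⊢
    exact ⟨fun h' => h.1 (MulAction.injective g h'), h.2.imp (hr g x y) (hr g y x)⟩
  have hreach_smul : ∀ (g : G) x y, Γ.Reachable x y → Γ.Reachable (g • x) (g • y) := by
    intro g x y h
    let F : Γ →g Γ := ⟨fun z => g • z, fun {a b} hab => hadj g a b hab⟩
    exact h.map F
  have hreach : ∀ g : G, Γ.Reachable x₀ (g • x₀) := by
    intro g
    have hg : g ∈ Subgroup.closure K := hgen ▸ Subgroup.mem_top g
    induction hg using Subgroup.closure_induction with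
    | mem k hk =>
      by_cases h : x₀ = k • x₀
      · exact h ▸ SimpleGraph.Reachable.refl _
      · exact (show Γ.Adj x₀ (k • x₀) from
          ⟨h, .inl ⟨1, k, hk, by simp, by simp⟩⟩).reachable
    | one => simp
    | mul g h _ _ hg hh =>
      rw [mul_smul]
      exact hg.trans (hreach_smul g _ _ hh)
    | inv g _ hg =>
      have := hreach_smul g⁻¹ _ _ hg
      rw [inv_smul_smul] at this
      exact this.symm
  refine ⟨Γ, hadj, ?_, fun x => ?_, fun x y => ?_, hopen, hcomp⟩
  · rw [SimpleGraph.connected_iff]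
    refine ⟨fun x y => ?_, ⟨x₀⟩⟩
    obtain ⟨g, rfl⟩ := htrans x
    obtain ⟨h, rfl⟩ := htrans y
    exact (hreach g).symm.trans (hreach h)
  · have h1 : IsCompact {g : G | g • x₀ = x} := isCompact_setOf_smul_eq (hcomp x₀) x
    refine ((finite_image_smul (hopen x₀) (h1.mul hK)).union
      (finite_image_smul (hopen x₀) (h1.mul hK.inv))).subset fun y hy => ?_
    rw [SimpleGraph.mem_neighborSet, SimpleGraph.fromRel_adj] at hy
    rcases hy.2 with ⟨g, k, hk, rfl, rfl⟩ | ⟨g, k, hk, rfl, rfl⟩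
    · exact .inl ⟨g * k, Set.mul_mem_mul rfl hk, rfl⟩
    · exact .inr ⟨g * k * k⁻¹, Set.mul_mem_mul rfl (Set.inv_mem_inv.2 hk), by simp⟩
  · obtain ⟨g, rfl⟩ := htrans x
    obtain ⟨h, rfl⟩ := htrans y
    exact ⟨h * g⁻¹, by rw [mul_smul, inv_smul_smul]⟩

end Existence

/-! ### Coarse maps and uniform bounds -/

section Coarse

variable {G : Type u} [Group G]

/-- A bound valid along each orbit becomes uniform by taking the maximum over the finitely many
orbit representatives. -/
lemma exists_uniform_of_orbits {Ω : Type*} [MulAction G Ω]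
    [hfin : Finite (MulAction.orbitRel.Quotient G Ω)] (P : Ω → ℕ → Prop)
    (hmono : ∀ ω C C', C ≤ C' → P ω C → P ω C') (h : ∀ ω, ∃ C, ∀ g : G, P (g • ω) C) :
    ∃ C, ∀ ω, P ω C := by
  choose C hC using h
  obtain ⟨B, hB⟩ := (Set.finite_range
    fun q : MulAction.orbitRel.Quotient G Ω => C q.out).bddAbove
  refine ⟨B, fun ω => ?_⟩
  obtain ⟨g, hg⟩ : ω ∈ MulAction.orbit G
      (Quotient.mk _ ω : MulAction.orbitRel.Quotient G Ω).out :=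
    (MulAction.orbitRel G Ω).symm (Quotient.mk_out (s := MulAction.orbitRel G Ω) ω)
  rw [← hg]
  exact hmono _ _ _ (hB ⟨_, rfl⟩) (hC _ g)

variable [TopologicalSpace G] {V : Type v} [MulAction G V] {Γ : SimpleGraph V}

/-- A map that is equivariant up to a bounded error. -/
def IsCoarselyEquivariant (G : Type*) [Group G] {V Ω : Type*} [MulAction G V] [MulAction G Ω]
    (Γ : SimpleGraph V) (π : Ω → V) : Prop :=
  ∃ K : ℕ, ∀ (g : G) ω, Γ.dist (π (g • ω)) (g • π ω) ≤ K

/-- A point stabilizer need not fix a vertex, so strict equivariance is not available. Sending h·c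
to h x₀ for orbit representatives c involves a choice of h up to the compact stabilizer of c, which
moves x₀ a bounded distance. -/
lemma IsCayleyAbelsGraph.exists_coarselyEquivariant [IsTopologicalGroup G]
    (hΓ : IsCayleyAbelsGraph G Γ) {Ω : Type*}
    [MulAction G Ω] (hΩ : IsFiniteTypeProper G Ω) :
    ∃ π : Ω → V, IsCoarselyEquivariant G Γ π := by
  obtain ⟨x₀⟩ := hΓ.connected.nonempty
  have := hΩ.finite_orbits
  let q : Ω → MulAction.orbitRel.Quotient G Ω := fun ω => Quotient.mk _ ω
  have hq : ∀ (g : G) ω, q (g • ω) = q ω := fun g ω => Quotient.sound ⟨g, rfl⟩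
  have hrep : ∀ ω, ∃ g : G, g • (q ω).out = ω := fun ω =>
    (MulAction.orbitRel G Ω).symm (Quotient.mk_out (s := MulAction.orbitRel G Ω) ω)
  choose h hh using hrep
  have hbd : ∀ c : MulAction.orbitRel.Quotient G Ω, ∃ K, ∀ s ∈ MulAction.stabilizer G c.out,
      Γ.dist x₀ (s • x₀) ≤ K := fun c => by
    obtain ⟨K, hK⟩ := ((finite_image_smul (hΓ.isOpen_stabilizer x₀)
      (hΩ.isCompact_stabilizer c.out)).image (Γ.dist x₀)).bddAbove
    exact ⟨K, fun s hs => hK ⟨_, ⟨s, hs, rfl⟩, rfl⟩⟩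
  choose K hK using hbd
  obtain ⟨B, hB⟩ := (Set.finite_range K).bddAbove
  refine ⟨fun ω => h ω • x₀, B, fun g ω => ?_⟩
  rw [smul_smul, ← hΓ.dist_smul (h (g • ω))⁻¹, inv_smul_smul, smul_smul]
  refine (hK (q ω) _ ?_).trans (hB ⟨_, rfl⟩)
  rw [MulAction.mem_stabilizer_iff, mul_smul, inv_smul_eq_iff, mul_smul, hh]
  have h1 := hh (g • ω)
  rw [hq] at h1
  exact h1.symm

/-- Equivariant maps into a permutation module have bounded norm and bounded displacement. -/
lemma IsCayleyAbelsGraph.exists_displacement_bound (hΓ : IsCayleyAbelsGraph G Γ) {Ω Ω' : Type*}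
    [MulAction G Ω] [MulAction G Ω'] [Finite (MulAction.orbitRel.Quotient G Ω)]
    (F : Ω → MonoidAlgebra ℚ Ω')
    (hF : ∀ (g : G) ω, F (g • ω) = Representation.ofMulAction ℚ G Ω' g (F ω))
    {π : Ω → V} (hπ : IsCoarselyEquivariant G Γ π)
    {π' : Ω' → V} (hπ' : IsCoarselyEquivariant G Γ π') :
    ∃ C : ℕ, ∀ ω, l1Norm (F ω) ≤ C ∧ ∀ ω' ∈ (F ω).coeff.support, Γ.dist (π' ω') (π ω) ≤ C := by
  obtain ⟨K, hK⟩ := hπ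
  obtain ⟨K', hK'⟩ := hπ'
  refine exists_uniform_of_orbits (G := G) _ (fun ω C C' hC h => ⟨h.1.trans (by exact_mod_cast hC),
    fun ω' hω' => (h.2 ω' hω').trans hC⟩) fun ω => ?_
  obtain ⟨B, hB⟩ := ((F ω).coeff.support.finite_toSet.image
    fun ω' => Γ.dist (π' ω') (π ω)).bddAbove
  refine ⟨max ⌈l1Norm (F ω)⌉₊ (K' + B + K), fun g => ⟨?_, fun ω' hω' => ?_⟩⟩
  · rw [hF, l1Norm_ofMulAction]
    exact (Nat.le_ceil _).trans (by exact_mod_cast le_max_left _ _)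
  · rw [hF, Finsupp.mem_support_iff, Representation.coeff_ofMulAction,
      ← Finsupp.mem_support_iff] at hω'
    have h1 := hK' g (g⁻¹ • ω')
    rw [smul_inv_smul] at h1
    have h2 : Γ.dist (π' (g⁻¹ • ω')) (π ω) ≤ B := hB ⟨_, hω', rfl⟩
    have h3 := hK g ω
    rw [← hΓ.dist_smul g] at h2
    have h4 : Γ.dist (π' ω') (π (g • ω)) ≤ Γ.dist (π' ω') (g • π' (g⁻¹ • ω')) +
      Γ.dist (g • π' (g⁻¹ • ω')) (π (g • ω)) := hΓ.connected.dist_triangle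
    have h5 : Γ.dist (g • π' (g⁻¹ • ω')) (π (g • ω)) ≤ Γ.dist (g • π' (g⁻¹ • ω')) (g • π ω) +
      Γ.dist (g • π ω) (π (g • ω)) := hΓ.connected.dist_triangle
    rw [Γ.dist_comm (u := g • π ω)] at h5
    exact le_trans (by omega) (le_max_right _ _)

end Coarse

/-! ### Functionals on undistorted kernels -/

section Undistorted

variable {G : Type u} [Group G] [TopologicalSpace G] {Ω : Type v} [MulAction G Ω]

/-- Preimages of the basis elements can be chosen with uniformly bounded norm; extending linearly
gives a bounded section, which need not be equivariant. -/
lemma IsFillingNorm.exists_le_l1Norm [Finite (MulAction.orbitRel.Quotient G Ω)]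
    {μ : MonoidAlgebra ℚ Ω → ℝ} (hμ : IsFillingNorm (Representation.ofMulAction ℚ G Ω) μ) :
    ∃ C : ℝ, 0 ≤ C ∧ ∀ m, μ m ≤ C * l1Norm m := by
  obtain ⟨Ω', _, -, d, hd, hμ⟩ := hμ
  obtain ⟨C, hC⟩ := exists_uniform_of_orbits (G := G)
    (fun (ω : Ω) C => ∃ x, d x = single ω 1 ∧ l1Norm x ≤ (C : ℝ))
    (fun ω C C' hC ⟨x, hx, hl⟩ => ⟨x, hx, hl.trans (by exact_mod_cast hC)⟩) fun ω => by
      obtain ⟨x, hx⟩ := hd (single ω 1)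
      refine ⟨⌈l1Norm x⌉₊, fun g => ⟨Representation.ofMulAction ℚ G Ω' g x, ?_, ?_⟩⟩
      · rw [d.isIntertwining, hx, Representation.ofMulAction_single]
      · rw [l1Norm_ofMulAction]
        exact Nat.le_ceil _
  choose x hx hl using hC
  refine ⟨C, Nat.cast_nonneg C, fun m => ?_⟩
  rw [hμ]
  refine csInf_le_of_le ⟨0, ?_⟩ ⟨linExt x m, ?_, rfl⟩
    (l1Norm_map_le (linExt x) C (fun ω => by simpa using hl ω) m)
  · rintro _ ⟨y, -, rfl⟩
    exact l1Norm_nonneg y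
  · have : d.toLinearMap ∘ₗ linExt x = LinearMap.id := by
      refine linearMap_ext fun ω => ?_
      simpa using hx ω
    exact congrArg (fun f => f m) this

/-- A functional bounded on generators of an undistorted submodule is bounded for the
`ℓ¹`-norm. -/
lemma IsUndistorted.exists_functional_bound [Finite (MulAction.orbitRel.Quotient G Ω)]
    {N : Subrepresentation (Representation.ofMulAction ℚ G Ω)} (hN : IsUndistorted N) :
    ∃ (Ω' : Type u) (_ : MulAction G Ω') (F : Ω' → MonoidAlgebra ℚ Ω) (C : ℝ),
      IsFiniteTypeProper G Ω' ∧
      (∀ (g : G) ω, F (g • ω) = Representation.ofMulAction ℚ G Ω g (F ω)) ∧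
      (∀ ω, F ω ∈ N.toSubmodule) ∧ 0 ≤ C ∧
      ∀ (Φ : MonoidAlgebra ℚ Ω →ₗ[ℚ] ℝ) (K : ℝ), 0 < K → (∀ ω, |Φ (F ω)| ≤ K) →
        ∀ m ∈ N.toSubmodule, |Φ m| ≤ C * K * l1Norm m := by
  obtain ⟨μ, ν, hμ, ⟨Ω', A, hΩ', d, hd, hν⟩, -, C, hC, hνμ⟩ := hN
  obtain ⟨C', hC', hμC⟩ := hμ.exists_le_l1Norm
  refine ⟨Ω', A, fun ω => (d (single ω 1)).1, C * C', hΩ', fun g ω => ?_, fun ω => (d _).2,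
    by positivity, fun Φ K hK hΦ m hm => ?_⟩
  · beta_reduce
    rw [← Representation.ofMulAction_single, d.isIntertwining]
    rfl
  -- Every filling of m, written in the generators, bounds |Φ m| by K times its norm, so the infimum
  -- does too; undistortedness then passes from ν to the ℓ¹-norm.
  · have h1 : |Φ m| / K ≤ ν ⟨m, hm⟩ := by
      rw [hν]
      obtain ⟨x, hx⟩ := hd ⟨m, hm⟩
      refine le_csInf ⟨_, x, hx, rfl⟩ ?_
      rintro _ ⟨y, hy, rfl⟩
      rw [div_le_iff₀' hK]
      have := abs_map_le (Φ ∘ₗ N.toSubmodule.subtype ∘ₗ d.toLinearMap) K y fun ω _ => hΦ ω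
      have e : (Φ ∘ₗ N.toSubmodule.subtype ∘ₗ d.toLinearMap) y = Φ m :=
        congrArg (fun z : N.toSubmodule => Φ z) hy
      rwa [e] at this
    have h2 := h1.trans ((hνμ _).trans (mul_le_mul_of_nonneg_left (hμC m) hC.le))
    rw [div_le_iff₀' hK] at h2
    linarith

end Undistorted

/-! ### The weak linear isoperimetric inequality implies hyperbolicity -/

section WeakHyperbolic

/-- If the weights vary little on the support of a chain, they can be replaced by a constant. -/
lemma abs_linExt_mul_sub_le {Ω : Type*} (x : MonoidAlgebra ℚ Ω) (F h : Ω → ℝ) (c D H : ℝ)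
    (hD : 0 ≤ D) (hF : ∀ ω ∈ x.coeff.support, |F ω - c| ≤ D)
    (hH : ∀ ω ∈ x.coeff.support, |h ω| ≤ H) :
    |linExt (fun ω => F ω * h ω) x - c * linExt h x| ≤ D * H * l1Norm x := by
  have e : linExt (fun ω => F ω * h ω) x - c * linExt h x =
      linExt (fun ω => (F ω - c) * h ω) x := by
    simp only [linExt_apply, Finset.mul_sum, ← Finset.sum_sub_distrib, Rat.smul_def]
    refine Finset.sum_congr rfl fun ω _ => ?_
    ring
  rw [e]
  refine abs_map_le _ _ _ fun ω hω => ?_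
  rw [linExt_single, one_smul, abs_mul]
  exact mul_le_mul (hF ω hω) (hH ω hω) (abs_nonneg _) hD

variable {G : Type u} [Group G] [TopologicalSpace G] [IsTopologicalGroup G]

/-- A Cayley-Abels graph whose vertex set embeds in the basis of the module of `0`-chains of a
resolution satisfying the weak linear isoperimetric inequality has linear area. -/
theorem IsCayleyAbelsGraph.exists_hasLinearArea {V : Type u} [MulAction G V] {Γ : SimpleGraph V}
    (hΓ : IsCayleyAbelsGraph G Γ)
    {Ω₀ Ω₁ Ω₂ : Type u} [MulAction G Ω₀] [MulAction G Ω₁] [MulAction G Ω₂]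
    {d₂ : (Representation.ofMulAction ℚ G Ω₂).IntertwiningMap (Representation.ofMulAction ℚ G Ω₁)}
    {d₁ : (Representation.ofMulAction ℚ G Ω₁).IntertwiningMap (Representation.ofMulAction ℚ G Ω₀)}
    {ε : (Representation.ofMulAction ℚ G Ω₀).IntertwiningMap (Representation.trivial ℚ G ℚ)}
    (hres : IsPartialResolution d₂ d₁ ε) (hund : IsUndistorted d₁.ker)
    (ι : V → Ω₀) (hι : ∀ (g : G) v, ι (g • v) = g • ι v)
    (π₀ : Ω₀ → V) (hπ₀ : IsCoarselyEquivariant G Γ π₀) (hπι : ∀ v, π₀ (ι v) = v)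
    (e : ℚ) (he : e ≠ 0) (hε : ∀ v, ε (single (ι v) 1) = e) :
    ∃ C : ℝ, 0 ≤ C ∧ HasLinearArea Γ C := by
  have := hres.proper₀.finite_orbits
  have := hres.proper₁.finite_orbits
  obtain ⟨b, hb⟩ := hΓ.exists_coarselyEquivariant hres.proper₁
  obtain ⟨Ω', A', F, C₁, hΩ', hF, hFker, hC₁, hbound⟩ := hund.exists_functional_bound
  have := hΩ'.finite_orbits
  obtain ⟨b', hb'⟩ := hΓ.exists_coarselyEquivariant hΩ'
  obtain ⟨E, hE⟩ : ∃ E : ℕ, ∀ ω, |(ε (single ω 1) : ℝ)| ≤ E := by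
    refine exists_uniform_of_orbits (G := G) _
      (fun ω C C' hC h => h.trans (by exact_mod_cast hC)) fun ω =>
        ⟨⌈|(ε (single ω 1) : ℝ)|⌉₊, fun g => ?_⟩
    rw [← Representation.ofMulAction_single, ε.isIntertwining]
    exact Nat.le_ceil _
  obtain ⟨K₁, hK₁⟩ := hΓ.exists_displacement_bound (fun ω : Ω₁ => d₁ (single ω 1))
    (fun g ω => by rw [← d₁.isIntertwining, Representation.ofMulAction_single]) hb hπ₀
  obtain ⟨K₂, hK₂⟩ := hΓ.exists_displacement_bound F hF hb' hb
  -- Each edge of Γ lifts to a 1-chain of bounded norm supported near it. The bound is uniform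
  -- because edges fall into finitely many orbits and chains can be translated.
  have hedge : ∃ A : ℕ, ∀ p : ripsPairs Γ 1, ∃ s : MonoidAlgebra ℚ Ω₁,
      d₁ s = single (ι p.1.2) 1 - single (ι p.1.1) 1 ∧ l1Norm s ≤ A ∧
      ∀ ω ∈ s.coeff.support, Γ.dist (b ω) p.1.1 ≤ A := by
    let A₁ := hΓ.pairsAction 1
    obtain ⟨x₀⟩ := hΓ.connected.nonempty
    have : Finite (MulAction.orbitRel.Quotient G (ripsPairs Γ 1)) :=
      finite_quotient_of_finite (hΓ.finite_pairs 1 x₀) fun p => by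
        obtain ⟨g, hg⟩ := hΓ.transitive p.1.1 x₀
        exact ⟨g, hg⟩
    obtain ⟨K, hK⟩ := hb
    refine exists_uniform_of_orbits (G := G) _ (fun p C C' hC ⟨s, h1, h2, h3⟩ =>
      ⟨s, h1, h2.trans (by exact_mod_cast hC), fun ω hω => (h3 ω hω).trans hC⟩) fun p => ?_
    obtain ⟨s, hs⟩ := (hres.exact₀ (single (ι p.1.2) 1 - single (ι p.1.1) 1)).1
      (by rw [map_sub, hε, hε, sub_self])
    obtain ⟨B, hB⟩ := (s.coeff.support.finite_toSet.image fun ω => Γ.dist (b ω) p.1.1).bddAbove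
    refine ⟨max ⌈l1Norm s⌉₊ (K + B), fun g => ⟨Representation.ofMulAction ℚ G Ω₁ g s, ?_, ?_,
      fun ω hω => ?_⟩⟩
    · rw [d₁.isIntertwining, hs, map_sub, Representation.ofMulAction_single,
        Representation.ofMulAction_single, ← hι, ← hι]
      rfl
    · rw [l1Norm_ofMulAction]
      exact (Nat.le_ceil _).trans (by exact_mod_cast le_max_left _ _)
    · rw [Finsupp.mem_support_iff, Representation.coeff_ofMulAction,
        ← Finsupp.mem_support_iff] at hω
      have h1 := hK g (g⁻¹ • ω)
      rw [smul_inv_smul] at h1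
      have h2 : Γ.dist (b (g⁻¹ • ω)) p.1.1 ≤ B := hB ⟨_, hω, rfl⟩
      rw [← hΓ.dist_smul g] at h2
      have h4 : Γ.dist (b ω) (g • p.1.1) ≤ Γ.dist (b ω) (g • b (g⁻¹ • ω)) +
        Γ.dist (g • b (g⁻¹ • ω)) (g • p.1.1) := hΓ.connected.dist_triangle
      change Γ.dist (b ω) (g • p.1.1) ≤ _
      exact le_trans (by omega) (le_max_right _ _)
  obtain ⟨A, hA⟩ := hedge
  obtain ⟨H, hHdef⟩ : ∃ H : ℝ, H = 3 * K₁ * E * K₁ := ⟨_, rfl⟩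
  have hH0 : 0 ≤ H := by rw [hHdef]; positivity
  -- The added 1 makes T strictly positive, as `hbound` requires.
  obtain ⟨T, hTdef⟩ : ∃ T : ℝ, T = 3 * K₂ * H * K₂ + 1 := ⟨_, rfl⟩
  have hT0 : 0 < T := by rw [hTdef]; positivity
  have he' : 0 < |(e : ℝ)| := abs_pos.2 (by exact_mod_cast he)
  refine ⟨(C₁ * T * A + 3 * A * H * A) / |(e : ℝ)|, by positivity, fun f g hf hg v₀ p₀ => ?_⟩
  -- The weights ε make the extension of a constant function a multiple of ε, which kills
  -- boundaries. Then gl ∘ d₁ plays the role of dg, and Φ that of f dg.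
  let gl : MonoidAlgebra ℚ Ω₀ →ₗ[ℚ] ℝ := linExt fun ω => g (π₀ ω) * (ε (single ω 1) : ℝ)
  let Φ : MonoidAlgebra ℚ Ω₁ →ₗ[ℚ] ℝ := linExt fun ω => f (b ω) * gl (d₁ (single ω 1))
  have hlip : ∀ {f : V → ℝ}, IsThreeLipschitz Γ f → ∀ {x y : V} {K : ℕ}, Γ.dist x y ≤ K →
      |f x - f y| ≤ 3 * (K : ℝ) := fun hf x y K h =>
    (hf x y).trans (mul_le_mul_of_nonneg_left (by exact_mod_cast h) (by norm_num))
  have hgε : ∀ y : MonoidAlgebra ℚ Ω₀,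
      linExt (fun ω => (ε (single ω 1) : ℝ)) y = (ε y : ℝ) := fun y => by
    have e1 : ε y = ∑ ω ∈ y.coeff.support, y.coeff ω • ε (single ω 1) :=
      map_eq_sum ε.toLinearMap y
    rw [e1, linExt_apply, Rat.cast_sum]
    refine Finset.sum_congr rfl fun ω _ => ?_
    rw [smul_eq_mul, Rat.cast_mul, Rat.smul_def]
  have hgd : ∀ y : MonoidAlgebra ℚ Ω₁, linExt (fun ω => gl (d₁ (single ω 1))) y = gl (d₁ y) :=
    fun y => congrArg (fun T => T y) (linExt_eq (gl ∘ₗ d₁.toLinearMap))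
  have hεd : ∀ y, ε (d₁ y) = 0 := fun y => (hres.exact₀ _).2 ⟨y, rfl⟩
  -- On the boundary of a basis element g varies by at most a constant, and its constant part
  -- contributes ε ∘ d₁ = 0.
  have hglb : ∀ ω, |gl (d₁ (single ω 1))| ≤ H := fun ω => by
    have h1 := abs_linExt_mul_sub_le (d₁ (single ω 1)) (fun ω' => g (π₀ ω'))
      (fun ω' => (ε (single ω' 1) : ℝ)) (g (b ω)) (3 * K₁) E (by positivity)
      (fun ω' hω' => hlip hg ((hK₁ ω).2 ω' hω')) (fun ω' _ => hE ω')
    rw [hgε, hεd, Rat.cast_zero, mul_zero, sub_zero] at h1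
    refine h1.trans ?_
    rw [hHdef]
    exact mul_le_mul_of_nonneg_left (hK₁ ω).1 (by positivity)
  -- The same argument one degree higher: f is nearly constant on a generating cycle, and the
  -- constant part contributes gl (d₁ (F ω)) = 0.
  have hΦF : ∀ ω, |Φ (F ω)| ≤ T := fun ω => by
    have h1 := abs_linExt_mul_sub_le (F ω) (fun ω' => f (b ω'))
      (fun ω' => gl (d₁ (single ω' 1))) (f (b' ω)) (3 * K₂) H (by positivity)
      (fun ω' hω' => hlip hf ((hK₂ ω).2 ω' hω')) (fun ω' _ => hglb ω')
    have h2 : d₁ (F ω) = 0 := hFker ω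
    rw [hgd, h2, map_zero, mul_zero, sub_zero] at h1
    refine h1.trans ?_
    have h3 := mul_le_mul_of_nonneg_left (hK₂ ω).1 (by positivity : 0 ≤ 3 * (K₂ : ℝ) * H)
    rw [hTdef]
    linarith
  -- On the lift of an edge f is replaced by its value at the initial vertex, with bounded error;
  -- the augmentation e of the vertices appears as a factor.
  have hwalk : ∀ {u v : V} (p : Γ.Walk u v), ∃ y : MonoidAlgebra ℚ Ω₁,
      d₁ y = single (ι v) 1 - single (ι u) 1 ∧ l1Norm y ≤ A * p.length ∧
      |Φ y - e * lineIntegral f g p| ≤ 3 * A * H * A * p.length := by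
    intro u v p
    induction p with
    | nil => exact ⟨0, by simp⟩
    | @cons u w v h p ih =>
      obtain ⟨y, hy1, hy2, hy3⟩ := ih
      obtain ⟨s, hs1, hs2, hs3⟩ := hA ⟨(u, w), (SimpleGraph.dist_eq_one_iff_adj.2 h).le⟩
      dsimp only at hs1 hs3
      refine ⟨s + y, ?_, ?_, ?_⟩
      · rw [map_add, hs1, hy1]
        abel
      · rw [SimpleGraph.Walk.length_cons]
        push_cast
        linarith [l1Norm_add_le s y]
      · have h1 := abs_linExt_mul_sub_le s (fun ω' => f (b ω'))
          (fun ω' => gl (d₁ (single ω' 1))) (f u) (3 * A) H (by positivity)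
          (fun ω' hω' => hlip hf (hs3 ω' hω')) (fun ω' _ => hglb ω')
        have h2 : gl (d₁ s) = e * (g w - g u) := by
          rw [hs1, map_sub, linExt_single, linExt_single, one_smul, one_smul, hπι, hπι, hε, hε]
          ring
        rw [hgd, h2] at h1
        have h3 := mul_le_mul_of_nonneg_left hs2 (by positivity : 0 ≤ 3 * (A : ℝ) * H)
        have h4 : Φ (s + y) - e * lineIntegral f g (SimpleGraph.Walk.cons h p) =
            (Φ s - f u * (e * (g w - g u))) + (Φ y - e * lineIntegral f g p) := by
          rw [map_add, lineIntegral_cons]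
          ring
        rw [h4, SimpleGraph.Walk.length_cons]
        refine (abs_add_le _ _).trans ?_
        push_cast
        change |Φ s - _| ≤ _ at h1
        linarith
  obtain ⟨y, hy1, hy2, hy3⟩ := hwalk p₀
  have h1 := hbound Φ T hT0 hΦF y (by
    change d₁ y = 0
    rw [hy1, sub_self])
  have h2 := mul_le_mul_of_nonneg_left hy2 (by positivity : 0 ≤ C₁ * T)
  have h3 : |(e : ℝ)| * |lineIntegral f g p₀| ≤ |Φ y| + 3 * A * H * A * p₀.length := by
    rw [← abs_mul]
    have := abs_sub_abs_le_abs_sub ((e : ℝ) * lineIntegral f g p₀) (Φ y)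
    rw [abs_sub_comm _ (Φ y)] at this
    linarith
  rw [div_mul_eq_mul_div, le_div_iff₀ he']
  linarith

/-- Since ε is surjective, some basis element has nonzero augmentation. Its orbit supports a
Cayley–Abels graph whose vertices are 0-chains of the resolution, all with that same augmentation.
-/
theorem WeakLinearIsoperimetricInequality.isHyperbolic (hG : IsCompactlyGenerated G)
    (h : WeakLinearIsoperimetricInequality G) : IsHyperbolic G := by
  classical
  obtain ⟨Ω₀, Ω₁, Ω₂, _, _, _, d₂, d₁, ε, hres, hund⟩ := h
  obtain ⟨ω₀, hω₀⟩ : ∃ ω₀, ε (single ω₀ 1) ≠ 0 := by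
    by_contra! hcon
    obtain ⟨x, hx⟩ := hres.surjective 1
    have : ε.toLinearMap = 0 := linearMap_ext hcon
    have h1 : ε.toLinearMap x = 1 := hx
    rw [this, LinearMap.zero_apply] at h1
    exact zero_ne_one h1
  let V := MulAction.orbit G ω₀
  have hstab : ∀ v : V, MulAction.stabilizer G v = MulAction.stabilizer G (v : Ω₀) := fun v => by
    ext g
    rw [MulAction.mem_stabilizer_iff, MulAction.mem_stabilizer_iff, Subtype.ext_iff]
    rfl
  obtain ⟨Γ, hΓ⟩ := hG.exists_isCayleyAbelsGraph (V := V) ⟨ω₀, MulAction.mem_orbit_self ω₀⟩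
    (fun ⟨x, g, hg⟩ => ⟨g, Subtype.ext hg⟩)
    (fun v => by rw [hstab]; exact hres.proper₀.isOpen_stabilizer _)
    (fun v => by rw [hstab]; exact hres.proper₀.isCompact_stabilizer _)
  obtain ⟨π, K, hK⟩ := hΓ.exists_coarselyEquivariant hres.proper₀
  -- The coarse map is made the identity on the chosen orbit, so that g is recovered exactly on the
  -- endpoints of edges.
  let π₀ : Ω₀ → V := fun ω => if h : ω ∈ MulAction.orbit G ω₀ then ⟨ω, h⟩ else π ω
  have hπ₀ : IsCoarselyEquivariant G Γ π₀ := by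
    refine ⟨K, fun g ω => ?_⟩
    by_cases h : ω ∈ MulAction.orbit G ω₀
    · have h' : g • ω ∈ MulAction.orbit G ω₀ := MulAction.mem_orbit_of_mem_orbit g h
      have e1 : π₀ (g • ω) = g • π₀ ω := by
        simp only [π₀, dif_pos h, dif_pos h']
        rfl
      rw [e1, SimpleGraph.dist_self]
      exact Nat.zero_le _
    · have h' : g • ω ∉ MulAction.orbit G ω₀ := fun h' => h (by
        simpa using MulAction.mem_orbit_of_mem_orbit g⁻¹ h')
      simp only [π₀, dif_neg h, dif_neg h']
      exact hK g ω
  obtain ⟨C, hC, hA⟩ := hΓ.exists_hasLinearArea hres hund (fun v : V => (v : Ω₀))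
    (fun g v => rfl) π₀ hπ₀ (fun v => dif_pos v.2) (ε (single ω₀ 1)) hω₀ (by
      rintro ⟨_, g, rfl⟩
      change ε (single (g • ω₀) 1) = _
      rw [← Representation.ofMulAction_single, ε.isIntertwining]
      rfl)
  exact ⟨hG, V, inferInstance, Γ, hΓ, hA.isHyperbolicGraph hΓ.connected hC⟩

end WeakHyperbolic

end TDLC

/-! ### The equivalence -/

theorem mainTheorem3 (G : Type*) [Group G] [TopologicalSpace G] [IsTopologicalGroup G]
    [T2Space G] [LocallyCompactSpace G] [TotallyDisconnectedSpace G]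
    (hG : TDLC.IsCompactlyGenerated G) :
    TDLC.IsHyperbolic G ↔
      (TDLC.IsCompactlyPresented G ∧ TDLC.WeakLinearIsoperimetricInequality G) := by
  constructor
  · rintro ⟨-, V, _, Γ, hΓ, -, δ, hδ⟩
    exact ⟨hΓ.isCompactlyPresented hδ, hΓ.weakLinearIsoperimetricInequality hδ⟩
  · rintro ⟨-, h⟩
    exact h.isHyperbolic hG
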